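/- Let $(R,\mathfrak m,k)$ be a commutative Noetherian local ring. For a complex $X$ of $R$-modules put $$\operatorname{depth}_R(X):=\inf\{\, i\in\mathbb Z \mid \operatorname{Ext}^i_R(k,X)\neq 0\,\}\in\mathbb Z\cup\{\pm\infty\},$$ where $\operatorname{Ext}^i_R(k,X)=\operatorname{Hom}_{D(R)}(k,X[i])$, and let $\operatorname{depth}(R)$ be the depth of $R$ viewed as a complex in degree $0$. We say that a local ring $R$ satisfies *derived* $(\mathbf{ldep})$ if for all complexes $M$ and $N$ of $R$-modules with finitely generated homology modules such that $M$, $N$ and $M\otimes^{\mathbf L}_R N$ have bounded homology, one has $$\operatorname{depth}_R(M\otimes^{\mathbf L}_R N)+\operatorname{depth}(R)\ \ge\ \operatorname{depth}_R(M)+\operatorname{depth}_R(N).$$ **Proposition.** Let $(R,\mathfrak m,k)$ be a commutative Noetherian local ring (not necessarily Cohen–Macaulay) and let $x\in\mathfrak m$ be a nonzerodivisor on $R$. Then $R$ satisfies derived $(\mathbf{ldep})$ if and only if $R/xR$ satisfies derived $(\mathbf{ldep})$. -/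

import Mathlib

open CategoryTheory Opposite

universe u

noncomputable section

namespace DerivedDepth

/-- Cochain complexes `⋯ → X^i → X^(i+1) → ⋯`, indexed by `ℤ`, of modules over `R`.  In
homological notation `X_i = X^(-i)`. -/
abbrev Cplx (R : Type u) [CommRing R] := CochainComplex (ModuleCat.{u} R) ℤ

section Resolutions

variable {R : Type u} [CommRing R]

/-- The complex `X` has bounded homology: `H^i(X) = 0` for all `i < a` and all `i > b`, for some
integers `a`, `b`. -/
def HasBoundedHomology (X : Cplx R) : Prop :=
  ∃ a b : ℤ, X.IsGE a ∧ X.IsLE b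

/-- All homology modules of `X` are finitely generated. -/
def HasFGHomology (X : Cplx R) : Prop :=
  ∀ i : ℤ, Module.Finite R (X.homology i)

/-- A projective resolution of the complex `M`: a quasi-isomorphism `π : P ⟶ M` where `P` is a
complex of projective modules with `P^i = 0` for `i ≫ 0` (homologically: `P` is right bounded). -/
structure ProjRes (M : Cplx R) where
  /-- the resolving complex -/
  P : Cplx R
  /-- the augmentation -/
  π : P ⟶ M
  bounded : ∃ b : ℤ, P.IsStrictlyLE b
  projective : ∀ i : ℤ, Projective (P.X i)
  quasiIso : QuasiIso π

/-- The complex `P ⊗_R N` (the total complex, with direct sums), where `P` is a projective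
resolution of `M`.  It represents the derived tensor product `M ⊗ᴸ_R N`; up to isomorphism in
the derived category it does not depend on the resolution. -/
def ProjRes.derivedTensor {M : Cplx R} (F : ProjRes M) (N : Cplx R) : Cplx R :=
  HomologicalComplex.tensorObj F.P N

theorem quasiIso_of_opEquivalence {K L : Cplx R} (φ : K ⟶ L)
    (h : QuasiIso ((CochainComplex.opEquivalence (ModuleCat.{u} R)).functor.map φ.op)) :
    QuasiIso φ := by
  rw [quasiIso_iff] at h ⊢
  intro n
  obtain ⟨m, rfl⟩ : ∃ m : ℤ, n = -m := ⟨-n, by simp⟩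
  have h1 := h m
  rw [quasiIsoAt_iff' _ (m - 1) m (m + 1) (by simp) (by simp)] at h1
  rw [quasiIsoAt_iff' _ (-(m + 1)) (-m) (-(m - 1)) (by simp; ring) (by simp; ring)]
  rw [← ShortComplex.quasiIso_opMap_iff]
  exact h1

/-- Every complex whose homology is bounded above in cohomological degrees has a projective
resolution. -/
theorem ProjRes.nonempty_of_isLE (M : Cplx R) (n : ℤ) [M.IsLE n] : Nonempty (ProjRes M) := by
  let E := CochainComplex.opEquivalence (ModuleCat.{u} R)
  let K := M.truncLE n
  have hK : (E.functor.obj (op K)).IsStrictlyGE (-n) := by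
    rw [CochainComplex.isStrictlyGE_iff]
    intro i hi
    exact (K.isZero_of_isStrictlyLE n (-i) (by lia)).op
  obtain ⟨I, g, hg, hI, hI'⟩ :=
    CochainComplex.Plus.modelCategoryQuillen.exists_quasiIso_injective (E.functor.obj (op K)) (-n)
  let P : Cplx R := (E.inverse.obj I).unop
  let e : E.functor.obj (op P) ≅ I := E.counitIso.app I
  let φ : P ⟶ K := (E.functor.preimage (g ≫ e.inv)).unop
  have hφ : QuasiIso φ := by
    apply quasiIso_of_opEquivalence
    have : E.functor.map φ.op = g ≫ e.inv := E.functor.map_preimage _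
    change QuasiIso (E.functor.map φ.op)
    rw [this]
    infer_instance
  have eX (i : ℤ) : op (P.X i) ≅ I.X (-i) := by
    have e1 := (HomologicalComplex.eval _ _ (-i)).mapIso e
    have e2 : (E.functor.obj (op P)).X (-i) = op (P.X (- -i)) := rfl
    exact eqToIso (by simp) ≪≫ eqToIso e2.symm ≪≫ e1
  refine ⟨⟨P, φ ≫ M.ιTruncLE n, ⟨n, ?_⟩, ?_, inferInstance⟩⟩
  · rw [CochainComplex.isStrictlyLE_iff]
    intro i hi
    exact (((I.isZero_of_isStrictlyGE (-n) (-i) (by lia)).of_iso (eX i)).unop)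
  · intro i
    have : Injective (op (P.X i)) := Injective.of_iso (eX i).symm inferInstance
    exact Injective.projective_iff_injective_op.2 this

/-- In particular the complexes with bounded homology have projective resolutions. -/
theorem ProjRes.nonempty {M : Cplx R} (hM : HasBoundedHomology M) : Nonempty (ProjRes M) := by
  obtain ⟨_, b, _, _⟩ := hM
  exact ProjRes.nonempty_of_isLE M b

/-- `Ext^i_R(X, Y)` for complexes `X`, `Y` of `R`-modules and `i : ℤ`: morphisms `X ⟶ Y[i]` in the
derived category of `R`-modules.  For a module `X` and an injective resolution `I` of a complex `Y`
with bounded homology this is the group `H^i(Hom_R(X, I))`. -/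
def HyperExt (X Y : Cplx R) (i : ℤ) : Type (u + 1) :=
  letI : HasDerivedCategory.{u + 1} (ModuleCat.{u} R) := HasDerivedCategory.standard _
  ShiftedHom (DerivedCategory.Q.obj X) (DerivedCategory.Q.obj Y) i

/-- A module, viewed as a complex concentrated in degree zero. -/
def ofModule (M : Type u) [AddCommGroup M] [Module R M] : Cplx R :=
  (CochainComplex.singleFunctor (ModuleCat.{u} R) 0).obj (ModuleCat.of R M)

end Resolutions

section Depth

variable (R : Type u) [CommRing R] [IsLocalRing R]

/-- The depth of a complex `X` over the local ring `R` with residue field `k`: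
`inf {i | Ext^i_R(k, X) ≠ 0}`, with value `+∞` if there is no such `i` and `-∞` if these `i` are
not bounded below. -/
def depth (X : Cplx R) : EReal :=
  ⨅ (i : ℤ) (_ : Nontrivial (HyperExt (ofModule (R := R) (IsLocalRing.ResidueField R)) X i)),
    ((i : ℝ) : EReal)

/-- The local ring `R` satisfies derived **(ldep)**: for all complexes `M`, `N` with bounded and
finitely generated homology such that `M ⊗ᴸ_R N` (computed by any projective resolution of `M`)
has bounded homology, `depth (M ⊗ᴸ_R N) + depth R ≥ depth M + depth N`. -/
def DerivedLdep : Prop :=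
  ∀ M N : Cplx R,
    HasBoundedHomology M → HasFGHomology M → HasBoundedHomology N → HasFGHomology N →
    ∀ F : ProjRes M, HasBoundedHomology (F.derivedTensor N) →
      depth R (F.derivedTensor N) + depth R (ofModule R) ≥ depth R M + depth R N

end Depth

/-- The quotient of a local ring by an element of its maximal ideal is a local ring. -/
theorem isLocalRing_quotient {R : Type u} [CommRing R] [IsLocalRing R] {x : R}
    (hx : x ∈ IsLocalRing.maximalIdeal R) : IsLocalRing (R ⧸ Ideal.span {x}) := by
  have : Nontrivial (R ⧸ Ideal.span {x}) := by
    rw [Ideal.Quotient.nontrivial_iff, Ne, Ideal.span_singleton_eq_top]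
    exact hx
  exact IsLocalRing.of_surjective' (Ideal.Quotient.mk _) Ideal.Quotient.mk_surjective

end DerivedDepth

end

/-! Write `S = R/xR` and let `k` be the common residue field. Three facts compare depths over the
two rings. (a) If `x` is regular on every term of `P`, then `S ⊗ P` is the cokernel of `x` on `P`.
Since `x` acts as zero on `Ext(k, -)`, the long exact sequence breaks up and the depth of the
cokernel over `R` is one less than that of `P` (`depth_coker_smul`). (b) For a complex of
`S`-modules with bounded homology, depth over `R` and over `S` agree (`IsQuotientBy.depth_restrC`).
Together with (a) this gives `depth S + 1 = depth R`. (c) If `P` resolves over `R` a complex `Y` of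
`S`-modules, then `S ⊗ P` is an extension of `Y` by a complex isomorphic to `Y[1]` in `D(S)`
(`exists_fourTerm`). This yields (b), with `Y = k`, and the descent to `S`.

From `S` to `R`: resolve `M`, `N` by `P`, `H` and apply the hypothesis to `S ⊗ P`, `S ⊗ H`. Their
tensor product over `S` is `P ⊗ (S ⊗ H)`, the cokernel of `x` on `P ⊗ H`, so all four depths drop by
exactly one and the inequality transfers.

From `R` to `S`: let `Y` resolve `M` over `S` and `P` resolve `Y` over `R`. Then `P ⊗ N` is `(S ⊗ P)
⊗ N` over `S`, which by (c) is an extension of `Y ⊗ N` by its shift. So its homology is bounded and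
its depth is at most `depth (Y ⊗ N) - 1` (`depth_add_one_le`), which compensates for `depth R =
depth S + 1`. -/

open CategoryTheory Opposite

noncomputable section

set_option linter.unusedSectionVars false

namespace DerivedDepth

open Limits Pretriangulated

/-! ### Vanishing of shifted Homs along distinguished triangles -/

section Triangulated

variable {C : Type*} [Category* C] [Preadditive C] [HasZeroObject C] [HasShift C ℤ]
  [∀ n : ℤ, (shiftFunctor C n).Additive] [Pretriangulated C]

/-- All morphisms `A ⟶ X⟦i⟧` vanish. -/
def ShiftedHomVanishes (A X : C) (i : ℤ) : Prop := ∀ f : A ⟶ X⟦i⟧, f = 0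

namespace ShiftedHomVanishes

variable {A X : C} {i : ℤ}

theorem of_iso_right {Y : C} (e : X ≅ Y) (h : ShiftedHomVanishes A X i) :
    ShiftedHomVanishes A Y i := fun f => by
  have := h (f ≫ (e.inv⟦i⟧'))
  rw [← cancel_mono (e.inv⟦i⟧'), this, zero_comp]

theorem of_iso_left {B : C} (e : A ≅ B) (h : ShiftedHomVanishes A X i) :
    ShiftedHomVanishes B X i := fun f => by
  have := h (e.hom ≫ f)
  rw [← cancel_epi e.hom, this, comp_zero]

theorem of_isZero_left (h : IsZero A) : ShiftedHomVanishes A X i := fun _ => h.eq_of_src _ _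

theorem of_isZero_right (h : IsZero X) : ShiftedHomVanishes A X i := fun _ =>
  ((shiftFunctor C i).map_isZero h).eq_of_tgt _ _

theorem shift_iff {j : ℤ} (a : ℤ) (hij : a + i = j) :
    ShiftedHomVanishes A (X⟦a⟧) i ↔ ShiftedHomVanishes A X j := by
  let e : X⟦j⟧ ≅ X⟦a⟧⟦i⟧ := (shiftFunctorAdd' C a i j hij).app X
  constructor
  · intro h f
    rw [← cancel_mono e.hom, h (f ≫ e.hom), zero_comp]
  · intro h f
    rw [← cancel_mono e.inv, h (f ≫ e.inv), zero_comp]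

theorem shift_left_iff {j : ℤ} (hij : i + 1 = j) :
    ShiftedHomVanishes (A⟦(1 : ℤ)⟧) X j ↔ ShiftedHomVanishes A X i := by
  let e : X⟦j⟧ ≅ X⟦i⟧⟦(1 : ℤ)⟧ := (shiftFunctorAdd' C i 1 j hij).app X
  constructor
  · intro h f
    apply (shiftFunctor C (1 : ℤ)).map_injective
    rw [← cancel_mono e.inv, h (f⟦(1 : ℤ)⟧' ≫ e.inv), Functor.map_zero, zero_comp]
  · intro h f
    obtain ⟨g, hg⟩ := (shiftFunctor C (1 : ℤ)).map_surjective (f ≫ e.hom)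
    rw [← cancel_mono e.hom, ← hg, h g, Functor.map_zero, zero_comp]

variable {T : Triangle C} (hT : T ∈ distTriang C)
include hT

theorem obj₂ (h₁ : ShiftedHomVanishes A T.obj₁ i) (h₃ : ShiftedHomVanishes A T.obj₃ i) :
    ShiftedHomVanishes A T.obj₂ i := fun f => by
  obtain ⟨g, hg⟩ := Triangle.coyoneda_exact₂ _ (T.shift_distinguished hT i) f (h₃ _)
  rw [hg, h₁ g]
  exact zero_comp

theorem obj₃ {j : ℤ} (hij : i + 1 = j) (h₂ : ShiftedHomVanishes A T.obj₂ i)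
    (h₁ : ShiftedHomVanishes A T.obj₁ j) : ShiftedHomVanishes A T.obj₃ i :=
  obj₂ (rot_of_distTriang _ hT) h₂ ((shift_iff 1 (by lia)).2 h₁)

theorem obj₁ {j : ℤ} (hij : i + 1 = j) (h₃ : ShiftedHomVanishes A T.obj₃ i)
    (h₂ : ShiftedHomVanishes A T.obj₂ j) : ShiftedHomVanishes A T.obj₁ j :=
  obj₂ (inv_rot_of_distTriang _ hT) ((shift_iff (-1) (by lia)).2 h₃) h₂

theorem src₂ (h₁ : ShiftedHomVanishes T.obj₁ X i) (h₃ : ShiftedHomVanishes T.obj₃ X i) :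
    ShiftedHomVanishes T.obj₂ X i := fun f => by
  obtain ⟨g, hg⟩ := Triangle.yoneda_exact₂ _ hT f (h₁ _)
  rw [hg, h₃ g, comp_zero]

theorem src₃ {j : ℤ} (hij : i + 1 = j) (h₁ : ShiftedHomVanishes T.obj₁ X i)
    (h₂ : ShiftedHomVanishes T.obj₂ X j) : ShiftedHomVanishes T.obj₃ X j :=
  src₂ (rot_of_distTriang _ hT) h₂ ((shift_left_iff hij).2 h₁)

/-- If `T.mor₁` induces zero on `Hom(A, -⟦i⟧)` then `Hom(A, T.obj₂⟦i⟧)` embeds in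
`Hom(A, T.obj₃⟦i⟧)`. -/
theorem obj₂_of_mor₁ (h₁ : ∀ f : A ⟶ T.obj₁⟦i⟧, f ≫ T.mor₁⟦i⟧' = 0)
    (h₃ : ShiftedHomVanishes A T.obj₃ i) : ShiftedHomVanishes A T.obj₂ i := fun f => by
  obtain ⟨g, hg⟩ := Triangle.coyoneda_exact₂ _ (T.shift_distinguished hT i) f (h₃ _)
  rw [hg]
  -- The shifted triangle carries `T.mor₁⟦i⟧'` with the sign `(-1)^i`, which does not affect
  -- vanishing.
  exact (Linear.comp_units_smul (R := ℤ) g i.negOnePow (T.mor₁⟦i⟧')).trans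
    ((congrArg _ (h₁ g)).trans (smul_zero _))

/-- If `T.mor₁` induces zero on `Hom(A, -⟦j⟧)`, `j = i + 1`, then `Hom(A, T.obj₁⟦j⟧)` is a
quotient of `Hom(A, T.obj₃⟦i⟧)`. -/
theorem obj₁_of_mor₁ {j : ℤ} (hij : i + 1 = j)
    (h₁ : ∀ f : A ⟶ T.obj₁⟦j⟧, f ≫ T.mor₁⟦j⟧' = 0)
    (h₃ : ShiftedHomVanishes A T.obj₃ i) : ShiftedHomVanishes A T.obj₁ j := fun f => by
  obtain ⟨g, hg⟩ := Triangle.coyoneda_exact₂ _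
    ((T.invRotate).shift_distinguished (inv_rot_of_distTriang _ hT) j) f 
      ((Linear.comp_units_smul (R := ℤ) f j.negOnePow (T.mor₁⟦j⟧')).trans
        ((congrArg _ (h₁ f)).trans (smul_zero _)))
  rw [hg, (shift_iff (-1) (by lia)).2 h₃ g]
  exact zero_comp

end ShiftedHomVanishes

end Triangulated

/-! ### Vanishing of Ext in the derived category -/

section HyperExt

attribute [local instance] HasDerivedCategory.standard

variable {R : Type u} [CommRing R]

open DerivedCategory

/-- The group `Ext^i(K, X)` vanishes. -/
def ExtVanishes (K X : Cplx R) (i : ℤ) : Prop :=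
  ShiftedHomVanishes (Q.obj K) (Q.obj X) i

theorem nontrivial_hyperExt_iff (K X : Cplx R) (i : ℤ) :
    Nontrivial (HyperExt K X i) ↔ ¬ ExtVanishes K X i := by
  change Nontrivial (Q.obj K ⟶ (Q.obj X)⟦i⟧) ↔ _
  rw [← not_subsingleton_iff_nontrivial, not_iff_not]
  exact ⟨fun _ _ => Subsingleton.elim _ _, fun h => ⟨fun f g => (h f).trans (h g).symm⟩⟩

/-- The isomorphism in the derived category given by a quasi-isomorphism. -/
def isoOfQuasiIso {X Y : Cplx R} (f : X ⟶ Y) (hf : QuasiIso f) : Q.obj X ≅ Q.obj Y :=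
  haveI : IsIso (Q.map f) := (isIso_Q_map_iff_quasiIso _ f).2 hf
  asIso (Q.map f)

theorem isZero_Q_obj_of_acyclic {X : Cplx R} (hX : X.Acyclic) : IsZero (Q.obj X) := by
  have hz : IsZero ((HomologicalComplex.single (ModuleCat.{u} R) (ComplexShape.up ℤ) 0).obj
      (ModuleCat.of R PUnit)) :=
    Functor.map_isZero _ (ModuleCat.isZero_of_subsingleton _)
  have h : QuasiIso (0 : X ⟶ (HomologicalComplex.single (ModuleCat.{u} R) _ 0).obj
      (ModuleCat.of R PUnit)) := by
    rw [quasiIso_iff]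
    intro n
    rw [quasiIsoAt_iff_exactAt _ _ (hX n), HomologicalComplex.exactAt_iff_isZero_homology]
    exact (HomologicalComplex.homologyFunctor _ _ n).map_isZero hz
  exact (Q.map_isZero hz).of_iso (isoOfQuasiIso _ h)

namespace ExtVanishes

variable {K X : Cplx R} {i : ℤ}

theorem right_iff {Y : Cplx R} (f : X ⟶ Y) (hf : QuasiIso f) :
    ExtVanishes K X i ↔ ExtVanishes K Y i :=
  ⟨.of_iso_right (isoOfQuasiIso f hf), .of_iso_right (isoOfQuasiIso f hf).symm⟩

theorem left_iff {L : Cplx R} (f : K ⟶ L) (hf : QuasiIso f) :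
    ExtVanishes K X i ↔ ExtVanishes L X i :=
  ⟨.of_iso_left (isoOfQuasiIso f hf), .of_iso_left (isoOfQuasiIso f hf).symm⟩

theorem of_acyclic_left (h : K.Acyclic) : ExtVanishes K X i :=
  .of_isZero_left (isZero_Q_obj_of_acyclic h)

theorem of_acyclic_right (h : X.Acyclic) : ExtVanishes K X i :=
  .of_isZero_right (isZero_Q_obj_of_acyclic h)

variable {S : ShortComplex (Cplx R)} (hS : S.ShortExact)
include hS

theorem X₃ {j : ℤ} (hij : i + 1 = j) (h₂ : ExtVanishes K S.X₂ i) (h₁ : ExtVanishes K S.X₁ j) :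
    ExtVanishes K S.X₃ i :=
  ShiftedHomVanishes.obj₃ (triangleOfSES_distinguished hS) hij h₂ h₁

theorem X₁ {j : ℤ} (hij : i + 1 = j) (h₃ : ExtVanishes K S.X₃ i) (h₂ : ExtVanishes K S.X₂ j) :
    ExtVanishes K S.X₁ j :=
  ShiftedHomVanishes.obj₁ (triangleOfSES_distinguished hS) hij h₃ h₂

theorem src₂ (h₁ : ExtVanishes S.X₁ X i) (h₃ : ExtVanishes S.X₃ X i) : ExtVanishes S.X₂ X i :=
  ShiftedHomVanishes.src₂ (triangleOfSES_distinguished hS) h₁ h₃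

theorem src₃ {j : ℤ} (hij : i + 1 = j) (h₁ : ExtVanishes S.X₁ X i) (h₂ : ExtVanishes S.X₂ X j) :
    ExtVanishes S.X₃ X j :=
  ShiftedHomVanishes.src₃ (triangleOfSES_distinguished hS) hij h₁ h₂

end ExtVanishes

/-- Multiplication by a scalar killing `K` is zero on `Ext(K, -)`. -/
theorem comp_smul_eq_zero {K X : Cplx R} {x : R} (hK : x • 𝟙 K = 0) {i : ℤ}
    (f : Q.obj K ⟶ (Q.obj X)⟦i⟧) : f ≫ (Q.map (x • 𝟙 X))⟦i⟧' = 0 := by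
  rw [Functor.map_smul, Functor.map_smul, Linear.comp_smul, CategoryTheory.Functor.map_id,
    CategoryTheory.Functor.map_id, Category.comp_id, ← Category.id_comp f, ← Linear.smul_comp,
    ← CategoryTheory.Functor.map_id, ← Functor.map_smul, hK, Functor.map_zero, zero_comp]

/-- As `x` acts by zero on `Ext(K, X)`, the long exact sequence breaks into short exact sequences `0
→ Ext^i(K, X) → Ext^i(K, Y) → Ext^(i+1)(K, X) → 0`. -/
theorem extVanishes_coker_smul_iff {K X Y : Cplx R} {x : R} (hK : x • 𝟙 K = 0) {g : X ⟶ Y}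
    (w : (x • 𝟙 X) ≫ g = 0) (hS : (ShortComplex.mk _ g w).ShortExact) (i : ℤ) :
    ExtVanishes K Y i ↔ ExtVanishes K X i ∧ ExtVanishes K X (i + 1) := by
  refine ⟨fun h => ⟨?_, ?_⟩, fun h => ExtVanishes.X₃ hS rfl h.1 h.2⟩
  · exact ShiftedHomVanishes.obj₂_of_mor₁ (triangleOfSES_distinguished hS)
      (fun f => comp_smul_eq_zero hK f) h
  · exact ShiftedHomVanishes.obj₁_of_mor₁ (triangleOfSES_distinguished hS) rfl
      (fun f => comp_smul_eq_zero hK f) h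

/-- Orthogonality for the canonical t-structure: `X[i]` lives in degrees at least `b - i`, which
exceeds `a`. -/
theorem extVanishes_of_isLE_of_isGE (K X : Cplx R) (a b i : ℤ) [K.IsLE a] [X.IsGE b]
    (h : a + i < b) : ExtVanishes K X i := fun f => by
  have : ((Q.obj X)⟦i⟧).IsGE (b - i) := TStructure.t.isGE_shift _ b i _ (by lia)
  exact TStructure.t.zero f a (b - i) (by lia)

end HyperExt

/-! ### Depth, and its drop modulo a regular element -/

section Depth

variable {R : Type u} [CommRing R] [IsLocalRing R]

/-- The residue field, as a complex. -/
abbrev residueCplx (R : Type u) [CommRing R] [IsLocalRing R] : Cplx R :=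
  ofModule (R := R) (IsLocalRing.ResidueField R)

/-- The infimum of a set of integers, as an extended real number. -/
def einf (A : Set ℤ) : EReal := ⨅ i ∈ A, ((i : ℝ) : EReal)

theorem le_einf_iff {A : Set ℤ} {e : EReal} : e ≤ einf A ↔ ∀ i ∈ A, e ≤ ((i : ℝ) : EReal) := by
  simp [einf]

theorem einf_le {A : Set ℤ} {i : ℤ} (hi : i ∈ A) : einf A ≤ ((i : ℝ) : EReal) :=
  iInf₂_le i hi

theorem einf_empty : einf ∅ = ⊤ := by simp [einf]

theorem einf_eq_coe {A : Set ℤ} {d : ℤ} (hd : IsLeast A d) : einf A = ((d : ℝ) : EReal) :=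
  le_antisymm (einf_le hd.1) (le_einf_iff.2 fun i hi => by exact_mod_cast hd.2 hi)

theorem exists_isLeast_of_bddBelow {A : Set ℤ} (h : BddBelow A) (hA : A.Nonempty) :
    ∃ d, IsLeast A d := by
  obtain ⟨b, hb⟩ := h
  obtain ⟨d, hd, hd'⟩ := Int.exists_least_of_bdd (P := (· ∈ A)) ⟨b, fun z hz => hb hz⟩ hA
  exact ⟨d, hd, fun z hz => hd' z hz⟩

theorem depth_eq (X : Cplx R) : depth R X = einf {i | ¬ ExtVanishes (residueCplx R) X i} := by
  unfold depth einf
  simp only [nontrivial_hyperExt_iff]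
  rfl

theorem depth_congr {X Y : Cplx R} (f : X ⟶ Y) (hf : QuasiIso f) : depth R X = depth R Y := by
  rw [depth_eq, depth_eq]
  simp only [ExtVanishes.right_iff f hf]

instance : (residueCplx R).IsLE 0 := by
  have : (residueCplx R).IsStrictlyLE 0 := by unfold residueCplx ofModule; infer_instance
  infer_instance

/-- Ensures that the depth is `+∞` or an attained minimum, so that arguments about the lowest
nonvanishing Ext apply. -/
theorem bddBelow_not_extVanishes (X : Cplx R) (hX : HasBoundedHomology X) :
    BddBelow {i | ¬ ExtVanishes (residueCplx R) X i} := by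
  obtain ⟨a, b, _, _⟩ := hX
  refine ⟨a, fun i hi => ?_⟩
  by_contra h
  exact hi (extVanishes_of_isLE_of_isGE _ _ 0 a i (by lia))

theorem smul_id_residueCplx {x : R} (hx : x ∈ IsLocalRing.maximalIdeal R) :
    x • 𝟙 (residueCplx R) = 0 := by
  have h : x • 𝟙 (ModuleCat.of R (IsLocalRing.ResidueField R)) = 0 := by
    ext a
    change x • a = 0
    rw [Algebra.smul_def, IsLocalRing.ResidueField.algebraMap_eq,
      (IsLocalRing.residue_eq_zero_iff x).2 hx, zero_mul]
  let F := HomologicalComplex.single (ModuleCat.{u} R) (ComplexShape.up ℤ) 0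
  have : x • 𝟙 (F.obj (ModuleCat.of R (IsLocalRing.ResidueField R))) = F.map (x • 𝟙 _) := by
    apply HomologicalComplex.from_single_hom_ext
    simp [F, HomologicalComplex.single_map_f_self]
  exact this.trans (by rw [h, Functor.map_zero]; rfl)

/-- Applied with `A` and `B` the degrees where `Ext(k, X)` and `Ext(k, X/xX)` are nonzero. No
boundedness is assumed, so the values `⊤` and `⊥` are treated separately. -/
theorem einf_add_one {A B : Set ℤ} (h : ∀ i, i ∈ B ↔ i ∈ A ∨ i + 1 ∈ A) :
    einf B + 1 = einf A := by
  rcases A.eq_empty_or_nonempty with rfl | hA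
  · have : B = ∅ := by ext i; simp [h]
    rw [this, einf_empty]
    exact EReal.top_add_of_ne_bot (EReal.coe_ne_bot 1)
  by_cases hb : BddBelow A
  · obtain ⟨d, hd⟩ := exists_isLeast_of_bddBelow hb hA
    have hd' : IsLeast B (d - 1) := by
      refine ⟨(h _).2 (Or.inr (by simpa using hd.1)), fun i hi => ?_⟩
      rcases (h i).1 hi with hi | hi
      · have := hd.2 hi; lia
      · have := hd.2 hi; lia
    rw [einf_eq_coe hd, einf_eq_coe hd']
    have : ((d - 1 : ℤ) : ℝ) + 1 = (d : ℝ) := by push_cast; ring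
    rw [← this]; rfl
  -- Here `A` is unbounded below, hence so is `B`, which contains `A`; both infima are `⊥`.
  · have key : ∀ D : Set ℤ, ¬ BddBelow D → einf D = ⊥ := by
      intro D hD
      rw [EReal.eq_bot_iff_forall_lt]
      intro y
      obtain ⟨i, hi, hiy⟩ := not_bddBelow_iff.1 hD ⌊y⌋
      exact (einf_le hi).trans_lt (by
        have := Int.lt_floor_iff.1 hiy
        exact_mod_cast (show (i : ℝ) < y by linarith))
    rw [key A hb, key B, EReal.bot_add]
    rintro ⟨b, hb'⟩
    exact hb ⟨b, fun i hi => hb' ((h i).2 (Or.inl hi))⟩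

theorem depth_coker_smul {X Y : Cplx R} {x : R} (hx : x ∈ IsLocalRing.maximalIdeal R) {g : X ⟶ Y}
    (w : (x • 𝟙 X) ≫ g = 0) (hS : (ShortComplex.mk _ g w).ShortExact) :
    depth R Y + 1 = depth R X := by
  rw [depth_eq, depth_eq]
  apply einf_add_one
  intro i
  simp only [Set.mem_ofPred_eq,
    extVanishes_coker_smul_iff (smul_id_residueCplx hx) w hS, not_and_or]

end Depth

open TensorProduct

/-! ### Extension and restriction of scalars on complexes -/

section BaseChange

variable (R S : Type u) [CommRing R] [CommRing S] [Algebra R S]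

/-- Restriction of scalars from `S` to `R`. -/
abbrev restr : ModuleCat.{u} S ⥤ ModuleCat.{u} R := ModuleCat.restrictScalars (algebraMap R S)

/-- Restriction of scalars on complexes. -/
abbrev restrC : Cplx S ⥤ Cplx R := (restr R S).mapHomologicalComplex (ComplexShape.up ℤ)

instance (Y : ModuleCat.{u} S) : IsScalarTower R S ((restr R S).obj Y) :=
  ⟨fun r s y => by
    change (r • s) • (y : Y) = algebraMap R S r • s • (y : Y)
    rw [Algebra.smul_def, mul_smul]⟩

/-- Extension of scalars from `R` to `S`. -/
def ext : ModuleCat.{u} R ⥤ ModuleCat.{u} S where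
  obj M := ModuleCat.of S (S ⊗[R] M)
  map f := ModuleCat.ofHom (f.hom.baseChange S)
  map_id M := by ext; simp
  map_comp f g := by ext; simp

instance : (ext R S).Additive where
  map_add {M N f g} := by
    apply ModuleCat.hom_ext
    change (f.hom + g.hom).baseChange S = f.hom.baseChange S + g.hom.baseChange S
    exact LinearMap.baseChange_add _ _

/-- Extension of scalars on complexes. -/
abbrev extC : Cplx R ⥤ Cplx S := (ext R S).mapHomologicalComplex (ComplexShape.up ℤ)

/-- The map `m ↦ 1 ⊗ m`. -/
def extUnit : 𝟭 (ModuleCat.{u} R) ⟶ ext R S ⋙ restr R S where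
  app M := ModuleCat.ofHom (Y := (restr R S).obj ((ext R S).obj M))
    { toFun m := (1 : S) ⊗ₜ[R] m
      map_add' := by intros; exact tmul_add _ _ _
      map_smul' r m := by
        change _ = (algebraMap R S r) • ((1 : S) ⊗ₜ[R] m)
        rw [algebraMap_smul, tmul_smul] }
  naturality M N f := by
    ext m
    change (1 : S) ⊗ₜ[R] (f.hom m) = f.hom.baseChange S (1 ⊗ₜ m)
    simp

/-- The unit of extension of scalars, on complexes. -/
def extCUnit (P : Cplx R) : P ⟶ (restrC R S).obj ((extC R S).obj P) where
  f i := (extUnit R S).app (P.X i)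
  comm' i j _ := (extUnit R S).naturality (P.d i j)

variable {R S}

theorem ext_hom_ext {M : ModuleCat.{u} R} {Y : ModuleCat.{u} S} {f g : (ext R S).obj M ⟶ Y}
    (h : (extUnit R S).app M ≫ (restr R S).map f = (extUnit R S).app M ≫ (restr R S).map g) :
    f = g := by
  apply ModuleCat.hom_ext
  have key : ∀ (f g : S ⊗[R] M →ₗ[S] Y), (∀ m : M, f (1 ⊗ₜ m) = g (1 ⊗ₜ m)) → f = g := by
    intro f g h
    refine LinearMap.ext fun z => ?_
    induction z using TensorProduct.induction_on with
    | zero => rw [map_zero, map_zero]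
    | add a b ha hb => rw [map_add, map_add, ha, hb]
    | tmul s m =>
      have : s ⊗ₜ[R] m = s • ((1 : S) ⊗ₜ[R] m) := by simp [TensorProduct.smul_tmul']
      rw [this, map_smul, map_smul, h]
  exact key _ _ fun m => congr($h m)

/-- The map `S ⊗ M ⟶ Y` induced by an `R`-linear map `M ⟶ Y`. -/
def extLift {M : ModuleCat.{u} R} {Y : ModuleCat.{u} S} (f : M ⟶ (restr R S).obj Y) :
    (ext R S).obj M ⟶ Y :=
  ModuleCat.ofHom (Y := Y) (show S ⊗[R] M →ₗ[S] ((restr R S).obj Y) from LinearMap.liftBaseChange S f.hom)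

theorem extUnit_extLift {M : ModuleCat.{u} R} {Y : ModuleCat.{u} S} (f : M ⟶ (restr R S).obj Y) :
    (extUnit R S).app M ≫ (restr R S).map (extLift f) = f := by
  ext m
  exact (LinearMap.liftBaseChange_tmul S f.hom 1 m).trans (one_smul S (f.hom m))

theorem extLift_unit {M : ModuleCat.{u} R} {Y : ModuleCat.{u} S} (g : (ext R S).obj M ⟶ Y) :
    extLift ((extUnit R S).app M ≫ (restr R S).map g) = g :=
  ext_hom_ext (extUnit_extLift _)

theorem extLift_comp {M : ModuleCat.{u} R} {Y Z : ModuleCat.{u} S} (f : M ⟶ (restr R S).obj Y)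
    (g : Y ⟶ Z) : extLift (f ≫ (restr R S).map g) = extLift f ≫ g := by
  apply ext_hom_ext
  rw [extUnit_extLift, Functor.map_comp, ← Category.assoc, extUnit_extLift]

theorem extLift_precomp {M N : ModuleCat.{u} R} {Y : ModuleCat.{u} S} (g : M ⟶ N)
    (f : N ⟶ (restr R S).obj Y) : extLift (g ≫ f) = (ext R S).map g ≫ extLift f := by
  apply ext_hom_ext
  rw [extUnit_extLift, Functor.map_comp]
  have h := (extUnit R S).naturality g =≫ (restr R S).map (extLift f)
  rw [Category.assoc, extUnit_extLift] at h
  exact h.trans (Category.assoc _ _ _)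

theorem extLift_zero (M : ModuleCat.{u} R) (Y : ModuleCat.{u} S) :
    extLift (0 : M ⟶ (restr R S).obj Y) = 0 := by
  apply ext_hom_ext
  rw [extUnit_extLift, Functor.map_zero, comp_zero]

theorem extLift_add {M : ModuleCat.{u} R} {Y : ModuleCat.{u} S} (f g : M ⟶ (restr R S).obj Y) :
    extLift (f + g) = extLift f + extLift g := by
  apply ext_hom_ext
  rw [extUnit_extLift, Functor.map_add, Preadditive.comp_add, extUnit_extLift, extUnit_extLift]

theorem extC_hom_ext {P : Cplx R} {Y : Cplx S} {f g : (extC R S).obj P ⟶ Y}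
    (h : extCUnit R S P ≫ (restrC R S).map f = extCUnit R S P ≫ (restrC R S).map g) : f = g := by
  ext1 i
  exact ext_hom_ext congr($(h).f i)

/-- The map of complexes `S ⊗ P ⟶ Y` induced by an `R`-linear map `P ⟶ Y`. -/
def extCLift {P : Cplx R} {Y : Cplx S} (f : P ⟶ (restrC R S).obj Y) : (extC R S).obj P ⟶ Y where
  f i := extLift (f.f i)
  comm' i j _ := (extLift_comp (f.f i) (Y.d i j)).symm.trans
    ((congrArg extLift (f.comm i j)).trans (extLift_precomp (P.d i j) (f.f j)))

theorem extCUnit_extCLift {P : Cplx R} {Y : Cplx S} (f : P ⟶ (restrC R S).obj Y) :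
    extCUnit R S P ≫ (restrC R S).map (extCLift f) = f := by
  ext1 i
  exact extUnit_extLift (f.f i)

/-- A nullhomotopy of an `R`-linear map `P ⟶ Y` extends to `S ⊗ P ⟶ Y`. -/
def extHomotopy {P : Cplx R} {Y : Cplx S} {g : (extC R S).obj P ⟶ Y}
    (h : Homotopy (extCUnit R S P ≫ (restrC R S).map g) 0) : Homotopy g 0 where
  hom i j := extLift (h.hom i j)
  zero i j hij := (congrArg extLift (h.zero i j hij)).trans (extLift_zero _ _)
  comm i := by
    have h1 := h.comm i
    rw [dNext_eq _ (show (ComplexShape.up ℤ).Rel i (i + 1) from rfl),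
      prevD_eq _ (show (ComplexShape.up ℤ).Rel (i - 1) i by simp), HomologicalComplex.zero_f,
      add_zero] at h1
    let H : ∀ i j, ((extC R S).obj P).X i ⟶ Y.X j := fun i j => extLift (h.hom i j)
    have h2 : dNext i H = (ext R S).map (P.d i (i + 1)) ≫ extLift (h.hom (i + 1) i) :=
      dNext_eq H rfl
    have h3 : prevD i H = extLift (h.hom i (i - 1)) ≫ Y.d (i - 1) i :=
      prevD_eq H (show (ComplexShape.up ℤ).Rel (i - 1) i by simp)
    have h4 : g.f i = (ext R S).map (P.d i (i + 1)) ≫ extLift (h.hom (i + 1) i) +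
        extLift (h.hom i (i - 1)) ≫ Y.d (i - 1) i := by
      refine (extLift_unit (g.f i)).symm.trans ((congrArg extLift h1).trans
        ((extLift_add _ _).trans ?_))
      exact congr($(extLift_precomp (P.d i (i + 1)) (h.hom (i + 1) i)) +
        $(extLift_comp (h.hom i (i - 1)) (Y.d (i - 1) i)))
    refine h4.trans ?_
    rw [HomologicalComplex.zero_f, add_zero]
    exact congr($h2.symm + $h3.symm)

theorem nonempty_homotopy_extCUnit_iff {P : Cplx R} {Y : Cplx S} (g : (extC R S).obj P ⟶ Y) :
    Nonempty (Homotopy (extCUnit R S P ≫ (restrC R S).map g) 0) ↔ Nonempty (Homotopy g 0) := by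
  refine ⟨fun ⟨h⟩ => ⟨extHomotopy h⟩, fun ⟨h⟩ => ⟨?_⟩⟩
  refine (((restr R S).mapHomotopy h).compLeft (extCUnit R S P)).trans (.ofEq ?_)
  rw [Functor.map_zero, comp_zero]

end BaseChange

/-! ### Ext out of K-projective complexes and change of rings -/

section KProjective

attribute [local instance] HasDerivedCategory.standard

open DerivedCategory

/-- Out of a K-projective complex, morphisms in the derived category are homotopy classes of chain
maps. In this form the Hom-tensor adjunction can be applied degree by degree. -/
theorem extVanishes_iff_homotopy {R : Type u} [CommRing R] (K X : Cplx R) [K.IsKProjective]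
    (i : ℤ) : ExtVanishes K X i ↔ ∀ f : K ⟶ X⟦i⟧, Nonempty (Homotopy f 0) := by
  have hb := CochainComplex.IsKProjective.Qh_map_bijective K
    ((HomotopyCategory.quotient _ _).obj (X⟦i⟧))
  let e : Q.obj (X⟦i⟧) ≅ (Q.obj X)⟦i⟧ := (Q.commShiftIso i).app X
  let eK := (quotientCompQhIso (ModuleCat R)).app K
  let eX := (quotientCompQhIso (ModuleCat R)).app (X⟦i⟧)
  have key : ∀ f : K ⟶ X⟦i⟧, Qh.map ((HomotopyCategory.quotient _ _).map f) =
      eK.hom ≫ Q.map f ≫ eX.inv := fun f => by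
    have := (quotientCompQhIso (ModuleCat R)).hom.naturality f
    rw [← Category.assoc, Iso.eq_comp_inv]
    exact this
  constructor
  · intro h f
    have h0 : Q.map f = 0 := by
      rw [← cancel_mono e.hom, zero_comp]
      exact h _
    refine ⟨HomotopyCategory.homotopyOfEq _ _ (hb.1 ?_)⟩
    rw [key, h0, Functor.map_zero, Functor.map_zero, zero_comp, comp_zero]
  · intro h f
    obtain ⟨g, hg⟩ := hb.2 (eK.hom ≫ (f ≫ e.inv) ≫ eX.inv)
    obtain ⟨g, rfl⟩ := (HomotopyCategory.quotient _ _).map_surjective g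
    obtain ⟨hh⟩ := h g
    rw [HomotopyCategory.eq_of_homotopy g 0 hh, Functor.map_zero, Functor.map_zero] at hg
    rw [← cancel_mono e.inv, ← cancel_mono eX.inv, ← cancel_epi eK.hom, ← hg]
    simp

variable {R S : Type u} [CommRing R] [CommRing S] [Algebra R S]

/-- Ext over `S` out of `S ⊗ P` agrees with Ext over `R` out of `P`, for `P` K-projective. -/
theorem extVanishes_ext_iff (P : Cplx R) (X : Cplx S) [P.IsKProjective]
    [((extC R S).obj P).IsKProjective] (i : ℤ) :
    ExtVanishes ((extC R S).obj P) X i ↔ ExtVanishes P ((restrC R S).obj X) i := by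
  rw [extVanishes_iff_homotopy, extVanishes_iff_homotopy]
  let e : (restrC R S).obj (X⟦i⟧) ≅ ((restrC R S).obj X)⟦i⟧ :=
    ((restrC R S).commShiftIso i).app X
  constructor
  · intro h f
    obtain ⟨hg⟩ := (nonempty_homotopy_extCUnit_iff _).2 (h (extCLift (f ≫ e.inv)))
    rw [extCUnit_extCLift] at hg
    exact ⟨(Homotopy.ofEq (by simp)).trans ((hg.compRight e.hom).trans (.ofEq (by simp)))⟩
  · intro h g
    rw [← nonempty_homotopy_extCUnit_iff]
    obtain ⟨hg⟩ := h ((extCUnit R S P ≫ (restrC R S).map g) ≫ e.hom)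
    exact ⟨(Homotopy.ofEq (by simp)).trans ((hg.compRight e.inv).trans (.ofEq (by simp)))⟩

end KProjective

/-! ### Short exact sequences of complexes and epimorphic resolutions -/

section ShortExact

variable {R : Type u} [CommRing R]

theorem shortExact_of_forall {S : ShortComplex (Cplx R)}
    (hf : ∀ i, Function.Injective (S.f.f i)) (hfg : ∀ i, Function.Exact (S.f.f i) (S.g.f i))
    (hg : ∀ i, Function.Surjective (S.g.f i)) : S.ShortExact := by
  apply HomologicalComplex.shortExact_of_degreewise_shortExact
  intro i
  exact ModuleCat.shortComplex_shortExact _ (hfg i) (hf i) (hg i)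

section

variable {S : ShortComplex (Cplx R)} (hS : S.ShortExact)
include hS

theorem shortExact_eval (i : ℤ) : (S.map (HomologicalComplex.eval _ _ i)).ShortExact :=
  hS.map_of_exact (HomologicalComplex.eval _ _ i)

theorem injective_f_of_shortExact (i : ℤ) : Function.Injective (S.f.f i) :=
  (shortExact_eval hS i).moduleCat_injective_f

theorem exact_of_shortExact (i : ℤ) : Function.Exact (S.f.f i) (S.g.f i) :=
  (ShortComplex.ShortExact.moduleCat_exact_iff_function_exact _).1 (shortExact_eval hS i).exact

theorem surjective_g_of_shortExact (i : ℤ) : Function.Surjective (S.g.f i) :=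
  (shortExact_eval hS i).moduleCat_surjective_g

theorem exactAt_X₃ {i j : ℤ} (hij : i + 1 = j) (h₂ : S.X₂.ExactAt i) (h₁ : S.X₁.ExactAt j) :
    S.X₃.ExactAt i := by
  rw [HomologicalComplex.exactAt_iff_isZero_homology] at h₁ h₂ ⊢
  exact (hS.homology_exact₃ i j hij).isZero_X₂ (h₂.eq_of_src _ _) (h₁.eq_of_tgt _ _)

end

/-- A complex which is bounded above admits an epimorphic quasi-isomorphism from a bounded above
complex of projectives. -/
theorem exists_epi_quasiIso_projective (M : Cplx R) (n : ℤ) [M.IsStrictlyLE n] :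
    ∃ (P : Cplx R) (π : P ⟶ M), Epi π ∧ QuasiIso π ∧ (∀ i, Projective (P.X i)) ∧
      P.IsStrictlyLE (n + 1) := by
  let E := CochainComplex.opEquivalence (ModuleCat.{u} R)
  have hK : (E.functor.obj (op M)).IsStrictlyGE (-n) := by
    rw [CochainComplex.isStrictlyGE_iff]
    intro i hi
    exact (M.isZero_of_isStrictlyLE n (-i) (by lia)).op
  -- Passing to the opposite category turns the question into an embedding into injectives.
  -- Requiring a monomorphism costs one extra degree, whence `n + 1`.
  obtain ⟨I, g, hg, hg', hI, hI'⟩ :=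
    CochainComplex.Plus.modelCategoryQuillen.exists_mono_quasiIso_injective
      (E.functor.obj (op M)) (-n - 1) (-n) (by lia)
  let P : Cplx R := (E.inverse.obj I).unop
  let e : E.functor.obj (op P) ≅ I := E.counitIso.app I
  let φ : P ⟶ M := (E.functor.preimage (g ≫ e.inv)).unop
  have hφ' : E.functor.map φ.op = g ≫ e.inv := E.functor.map_preimage _
  have eX (i : ℤ) : op (P.X i) ≅ I.X (-i) := by
    have e1 := (HomologicalComplex.eval _ _ (-i)).mapIso e
    have e2 : (E.functor.obj (op P)).X (-i) = op (P.X (- -i)) := rfl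
    exact eqToIso (by simp) ≪≫ eqToIso e2.symm ≪≫ e1
  refine ⟨P, φ, ?_, ?_, ?_, ?_⟩
  · have : Mono (E.functor.map φ.op) := by rw [hφ']; infer_instance
    have := E.functor.mono_of_mono_map this
    exact unop_epi_of_mono φ.op
  · apply quasiIso_of_opEquivalence
    change QuasiIso (E.functor.map φ.op)
    rw [hφ']
    infer_instance
  · intro i
    have : Injective (op (P.X i)) := Injective.of_iso (eX i).symm inferInstance
    exact Injective.projective_iff_injective_op.2 this
  · rw [CochainComplex.isStrictlyLE_iff]
    intro i hi
    exact (((I.isZero_of_isStrictlyGE (-n - 1) (-i) (by lia)).of_iso (eX i)).unop)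

end ShortExact

/-! ### Reduction modulo `x` -/

section Quotient

variable {R S : Type u} [CommRing R] [CommRing S] [Algebra R S]

variable (R S) in
/-- The `R`-algebra `S` is the quotient of `R` by the ideal generated by `x`. -/
structure IsQuotientBy (x : R) : Prop where
  surjective : Function.Surjective (algebraMap R S)
  algebraMap_eq_zero_iff : ∀ r : R, algebraMap R S r = 0 ↔ x ∣ r

namespace IsQuotientBy

variable {x : R} (h : IsQuotientBy R S x)
include h

theorem smul_restr (Y : ModuleCat.{u} S) (y : (restr R S).obj Y) : x • y = 0 := by
  change algebraMap R S x • (y : Y) = 0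
  rw [(h.algebraMap_eq_zero_iff x).2 dvd_rfl, zero_smul]

theorem smul_restrC_hom {P : Cplx R} {Y : Cplx S} (f : P ⟶ (restrC R S).obj Y) : x • f = 0 := by
  ext i p
  exact h.smul_restr (Y.X i) (f.f i p)

theorem extUnit_surjective (M : ModuleCat.{u} R) : Function.Surjective ((extUnit R S).app M) := by
  have key : ∀ z : S ⊗[R] M, ∃ m : M, (1 : S) ⊗ₜ[R] m = z := fun z => by
    induction z using TensorProduct.induction_on with
    | zero => exact ⟨0, tmul_zero _ _⟩
    | add a b ha hb =>
      obtain ⟨m, rfl⟩ := ha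
      obtain ⟨m', rfl⟩ := hb
      exact ⟨m + m', tmul_add _ _ _⟩
    | tmul s m =>
      obtain ⟨r, rfl⟩ := h.surjective s
      exact ⟨r • m, by rw [← smul_tmul, Algebra.algebraMap_eq_smul_one]⟩
  exact key

/-- Right exactness of `- ⊗ M` applied to `R → R → S`, the first map being multiplication by `x`. -/
theorem extUnit_eq_zero_iff (M : ModuleCat.{u} R) (m : M) :
    (extUnit R S).app M m = 0 ↔ ∃ m', m = x • m' := by
  have he : Function.Exact (LinearMap.lsmul R R x) (Algebra.linearMap R S) := fun r =>
    (h.algebraMap_eq_zero_iff r).trans ⟨fun ⟨c, hc⟩ => ⟨c, hc.symm⟩, fun ⟨c, hc⟩ => ⟨c, hc.symm⟩⟩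
  have := rTensor_exact M he h.surjective (1 ⊗ₜ m)
  have h1 : (Algebra.linearMap R S).rTensor M (1 ⊗ₜ m) = (1 : S) ⊗ₜ[R] m := by simp
  rw [h1] at this
  refine this.trans ⟨?_, ?_⟩
  · rintro ⟨z, hz⟩
    refine ⟨TensorProduct.lid R M z, ?_⟩
    have h2 : ∀ z, (LinearMap.lsmul R R x).rTensor M z = x • z := fun z => by
      induction z using TensorProduct.induction_on with
      | zero => simp
      | add a b ha hb => rw [map_add, ha, hb, smul_add]
      | tmul s m => simp [smul_tmul']
    rw [← map_smul, ← h2, hz]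
    simp
  · rintro ⟨m', rfl⟩
    exact ⟨1 ⊗ₜ m', by simp [tmul_smul, smul_tmul']⟩

theorem smul_comp_extCUnit (P : Cplx R) : (x • 𝟙 P) ≫ extCUnit R S P = 0 := by
  rw [Linear.smul_comp, h.smul_restrC_hom]

theorem shortExact_smul (P : Cplx R) (hP : ∀ i, IsSMulRegular (P.X i) x) :
    (ShortComplex.mk _ _ (h.smul_comp_extCUnit P)).ShortExact := by
  apply shortExact_of_forall
  · intro i
    exact hP i
  · intro i p
    refine (h.extUnit_eq_zero_iff _ p).trans ⟨fun ⟨c, hc⟩ => ⟨c, hc.symm⟩, fun ⟨c, hc⟩ => ⟨c, hc.symm⟩⟩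
  · intro i
    exact h.extUnit_surjective (P.X i)

/-- An `R`-linear map between complexes of `S`-modules is `S`-linear. -/
def preimage {Y Z : Cplx S} (f : (restrC R S).obj Y ⟶ (restrC R S).obj Z) : Y ⟶ Z where
  f i := ModuleCat.ofHom
    { toFun := fun y : Y.X i => (f.f i y : Z.X i)
      map_add' := fun a b => (f.f i).hom.map_add a b
      map_smul' := fun s y => by
        obtain ⟨r, rfl⟩ := h.surjective s
        exact (f.f i).hom.map_smul r y }
  comm' i j _ := by
    ext y
    exact congr($(f.comm i j) y)

end IsQuotientBy

theorem exactAt_iff_exact {R : Type u} [CommRing R] (X : Cplx R) (i : ℤ) :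
    X.ExactAt i ↔ Function.Exact (X.d (i - 1) i) (X.d i (i + 1)) := by
  rw [HomologicalComplex.exactAt_iff' X (i - 1) i (i + 1) (by simp) (by simp)]
  exact ShortComplex.ShortExact.moduleCat_exact_iff_function_exact _

theorem exactAt_restrC_iff (Y : Cplx S) (i : ℤ) :
    ((restrC R S).obj Y).ExactAt i ↔ Y.ExactAt i := by
  rw [exactAt_iff_exact, exactAt_iff_exact]
  rfl

/-- The homology of the restriction of scalars. -/
def restrCHomologyIso (Y : Cplx S) (i : ℤ) :
    ((restrC R S).obj Y).homology i ≅ (restr R S).obj (Y.homology i) :=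
  (Y.sc i).mapHomologyIso (restr R S)

theorem epi_of_forall_surjective {X Y : Cplx R} (f : X ⟶ Y)
    (h : ∀ i, Function.Surjective (f.f i)) : Epi f := by
  have := fun i => (ModuleCat.epi_iff_surjective (f.f i)).2 (h i)
  exact HomologicalComplex.epi_of_epi_f f this

theorem shortExact_kernel {X Y : Cplx R} (f : X ⟶ Y) [Epi f] :
    (ShortComplex.mk (kernel.ι f) f (kernel.condition f)).ShortExact where
  exact := ShortComplex.exact_kernel f

theorem shortExact_cokernel {X Y : Cplx R} (f : X ⟶ Y) [Mono f] :
    (ShortComplex.mk f (cokernel.π f) (cokernel.condition f)).ShortExact where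
  exact := ShortComplex.exact_cokernel f

/-- Let `P ⟶ Y` be an epimorphic quasi-isomorphism onto a complex of `S`-modules, where `x` is
regular on `P`.  Then `S ⊗ P` is an extension of `Y` by a complex `L`, and `L` is the quotient of an
acyclic complex `E` by `Y`. -/
theorem exists_fourTerm {x : R} (h : IsQuotientBy R S x) {P : Cplx R} {Y : Cplx S}
    (π : P ⟶ (restrC R S).obj Y) [Epi π] (hπ : QuasiIso π)
    (hP : ∀ i, IsSMulRegular (P.X i) x) :
    ∃ (E L : Cplx S) (a : Y ⟶ E) (b : E ⟶ L) (c : L ⟶ (extC R S).obj P) (d : (extC R S).obj P ⟶ Y)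
      (w : a ≫ b = 0) (w' : c ≫ d = 0), (ShortComplex.mk a b w).ShortExact ∧
        (ShortComplex.mk c d w').ShortExact ∧ E.Acyclic := by
  -- Since `x` kills `Y`, one has `xP ⊆ K`. The complexes are `E = K/xK` and `L = K/xP`, the latter
  -- realised as the kernel of `P/xP → Y`. The map `a` sends `π p` to the class of `x p`; it is `Y ≅
  -- P/K ≅ xP/xK ⊆ K/xK`.
  let K := kernel π
  let ι : K ⟶ P := kernel.ι π
  have hK : (ShortComplex.mk ι π (kernel.condition π)).ShortExact := shortExact_kernel π
  have hι := injective_f_of_shortExact hK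
  have hιπ := exact_of_shortExact hK
  have hπs := surjective_g_of_shortExact hK
  dsimp only at hι hιπ hπs
  let d : (extC R S).obj P ⟶ Y := extCLift π
  have hd : ∀ i p, d.f i ((extUnit R S).app (P.X i) p) = π.f i p := fun i p =>
    congr(($(extCUnit_extCLift π)).f i p)
  have : Epi d := epi_of_forall_surjective d fun i y => by
    obtain ⟨p, hp⟩ := hπs i y
    exact ⟨_, (hd i p).trans hp⟩
  let b : (extC R S).obj K ⟶ kernel d := kernel.lift d ((extC R S).map ι) (by
    apply extC_hom_ext
    ext i k
    change d.f i (((extC R S).map ι).f i ((extUnit R S).app (K.X i) k)) = 0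
    refine (congrArg (d.f i) ?_).trans ((hd i (ι.f i k)).trans ((hιπ i).apply_apply_eq_zero k))
    exact congr($((extUnit R S).naturality (ι.f i)) k).symm)
  have hc := shortExact_kernel d
  have hbc : ∀ i k, (kernel.ι d).f i (b.f i ((extUnit R S).app (K.X i) k)) =
      (extUnit R S).app (P.X i) (ι.f i k) := fun i k => by
    have h1 : b ≫ kernel.ι d = (extC R S).map ι := kernel.lift_ι _ _ _
    exact congr(($h1).f i ((extUnit R S).app (K.X i) k)).trans
      congr($((extUnit R S).naturality (ι.f i)) k).symm
  let xl : P ⟶ K := kernel.lift π (x • 𝟙 P) (by rw [Linear.smul_comp, h.smul_restrC_hom])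
  have hxl : ∀ i p, ι.f i (xl.f i p) = x • p := fun i p =>
    congr(($(kernel.lift_ι π (x • 𝟙 P) (by rw [Linear.smul_comp, h.smul_restrC_hom]))).f i p)
  let θ : P ⟶ (restrC R S).obj ((extC R S).obj K) := xl ≫ extCUnit R S K
  -- For `k` in `K` the element `x k` lies in `xK`, so `p ↦ [x p]` descends along `π` to `Y`.
  have hθ : ι ≫ θ = 0 := by
    have : ι ≫ xl = x • 𝟙 K := by
      rw [← cancel_mono ι, Category.assoc, kernel.lift_ι]
      simp
    rw [← Category.assoc, this, h.smul_comp_extCUnit]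
  let a' := hK.exact.desc θ hθ
  have ha' : ∀ i p, a'.f i (π.f i p) = (extUnit R S).app (K.X i) (xl.f i p) := fun i p =>
    congr(($(hK.exact.g_desc θ hθ)).f i p)
  let a : Y ⟶ (extC R S).obj K := h.preimage a'
  have ha : ∀ i p, a.f i (π.f i p) = (extUnit R S).app (K.X i) (xl.f i p) := ha'
  have hcinj := injective_f_of_shortExact hc
  have hcex := exact_of_shortExact hc
  dsimp only at hcinj hcex
  have hab : a ≫ b = 0 := by
    ext i y
    obtain ⟨p, rfl⟩ := hπs i y
    apply hcinj i
    refine (congrArg _ (congrArg (b.f i) (ha i p))).trans ((hbc i _).trans ?_)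
    rw [hxl]
    exact ((h.extUnit_eq_zero_iff _ _).2 ⟨p, rfl⟩).trans (map_zero ((kernel.ι d).f i).hom).symm
  refine ⟨_, kernel d, a, b, kernel.ι d, d, hab, kernel.condition d, ?_, hc, ?_⟩
  · apply shortExact_of_forall
    · intro i
      refine (injective_iff_map_eq_zero (a.f i).hom).2 fun y hy => ?_
      obtain ⟨p, rfl⟩ := hπs i y
      obtain ⟨k, hk⟩ := (h.extUnit_eq_zero_iff _ _).1 ((ha i p).symm.trans hy)
      -- If `x p = x k` with `k` in `K`, regularity of `x` on `P` forces `p = k`, so `π p = 0`.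
      have : x • p = x • ι.f i k := by rw [← hxl, hk, map_smul]
      rw [hP i this]
      exact (hιπ i).apply_apply_eq_zero k
    · intro i e
      refine ⟨fun he => ?_, ?_⟩
      · obtain ⟨k, rfl⟩ := h.extUnit_surjective _ e
        obtain ⟨p, hp⟩ := (h.extUnit_eq_zero_iff _ _).1 ((hbc i k).symm.trans
          ((congrArg _ he).trans (map_zero ((kernel.ι d).f i).hom)))
        refine ⟨π.f i p, (ha i p).trans (congrArg _ (hι i ?_))⟩
        rw [hxl, hp]
      · rintro ⟨y, rfl⟩
        exact congr(($hab).f i y)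
    · intro i l
      obtain ⟨p, hp⟩ := h.extUnit_surjective _ ((kernel.ι d).f i l)
      obtain ⟨k, hk⟩ := (hιπ i p).1 (by
        rw [← hd, hp]
        exact (hcex i).apply_apply_eq_zero l)
      refine ⟨(extUnit R S).app (K.X i) k, hcinj i ?_⟩
      exact (hbc i k).trans ((congrArg _ hk).trans hp)
  · intro i
    -- `K` is acyclic as the kernel of an epimorphic quasi-isomorphism, and `x` is regular on it;
    -- hence its quotient `K/xK` is acyclic.
    have hKr : ∀ i, IsSMulRegular (K.X i) x := fun i k k' hk => by
      apply hι i
      apply hP i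
      change x • ι.f i k = x • ι.f i k'
      rw [← map_smul, ← map_smul]
      exact congrArg _ hk
    have hKa : K.Acyclic := hK.acyclic_X₁ hπ
    rw [← exactAt_restrC_iff (R := R)]
    have := h.shortExact_smul K hKr
    exact exactAt_X₃ this rfl (hKa i) (hKa _)

end Quotient

/-! ### Boundedness and finite generation of homology -/

section Bounded

variable {R : Type u} [CommRing R]

theorem hasBoundedHomology_iff (X : Cplx R) :
    HasBoundedHomology X ↔ ∃ a b : ℤ, ∀ i, i < a ∨ b < i → X.ExactAt i := by
  constructor
  · rintro ⟨a, b, _, _⟩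
    exact ⟨a, b, fun i hi => hi.elim (fun hi => X.exactAt_of_isGE a i hi)
      fun hi => X.exactAt_of_isLE b i hi⟩
  · rintro ⟨a, b, h⟩
    exact ⟨a, b, (CochainComplex.isGE_iff _ _).2 fun i hi => h i (Or.inl hi),
      (CochainComplex.isLE_iff _ _).2 fun i hi => h i (Or.inr hi)⟩

theorem hasBoundedHomology_ofModule : HasBoundedHomology (ofModule (R := R) R) := by
  have : (ofModule (R := R) R).IsStrictlyLE 0 := by unfold ofModule; infer_instance
  have : (ofModule (R := R) R).IsStrictlyGE 0 := by unfold ofModule; infer_instance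
  exact ⟨0, 0, inferInstance, inferInstance⟩

theorem HasBoundedHomology.of_quasiIso {X Y : Cplx R} (f : X ⟶ Y) (hf : QuasiIso f) :
    HasBoundedHomology X ↔ HasBoundedHomology Y := by
  simp only [hasBoundedHomology_iff, exactAt_iff_of_quasiIsoAt f]

theorem HasFGHomology.of_quasiIso' {X Y : Cplx R} (f : X ⟶ Y) (hf : QuasiIso f)
    (hY : HasFGHomology Y) : HasFGHomology X := fun i =>
  haveI := hY i
  Module.Finite.equiv (isoOfQuasiIsoAt f i).symm.toLinearEquiv

section

variable {S : ShortComplex (Cplx R)} (hS : S.ShortExact)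
include hS

theorem HasBoundedHomology.X₂ (h₁ : HasBoundedHomology S.X₁) (h₃ : HasBoundedHomology S.X₃) :
    HasBoundedHomology S.X₂ := by
  rw [hasBoundedHomology_iff] at *
  obtain ⟨a, b, h₁⟩ := h₁
  obtain ⟨a', b', h₃⟩ := h₃
  exact ⟨min a a', max b b', fun i hi => hS.exactAt_X₂ i (h₁ i (by lia)) (h₃ i (by lia))⟩

theorem HasBoundedHomology.X₃ (h₁ : HasBoundedHomology S.X₁) (h₂ : HasBoundedHomology S.X₂) :
    HasBoundedHomology S.X₃ := by
  rw [hasBoundedHomology_iff] at *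
  obtain ⟨a, b, h₁⟩ := h₁
  obtain ⟨a', b', h₂⟩ := h₂
  exact ⟨min (a - 1) a', max b b', fun i hi =>
    exactAt_X₃ hS rfl (h₂ i (by lia)) (h₁ (i + 1) (by lia))⟩

theorem HasFGHomology.X₃ [IsNoetherianRing R] (h₁ : HasFGHomology S.X₁) (h₂ : HasFGHomology S.X₂) :
    HasFGHomology S.X₃ := fun i => by
  have he := (ShortComplex.ShortExact.moduleCat_exact_iff_function_exact _).1
    (hS.homology_exact₃ i (i + 1) rfl)
  have := h₁ (i + 1)
  have := h₂ i
  have n1 : IsNoetherian R (S.X₁.homology (i + 1)) := inferInstance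
  have n2 : IsNoetherian R (S.X₂.homology i) := inferInstance
  have : IsNoetherian R (S.X₃.homology i) :=
    isNoetherian_of_range_eq_ker _ _ (LinearMap.exact_iff.1 he).symm
  infer_instance

end

variable {S : Type u} [CommRing S] [Algebra R S]

theorem hasBoundedHomology_restrC_iff (Y : Cplx S) :
    HasBoundedHomology ((restrC R S).obj Y) ↔ HasBoundedHomology Y := by
  simp only [hasBoundedHomology_iff, exactAt_restrC_iff]

theorem IsQuotientBy.hasFGHomology_restrC_iff {x : R} (h : IsQuotientBy R S x) (Y : Cplx S) :
    HasFGHomology ((restrC R S).obj Y) ↔ HasFGHomology Y := by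
  have : Module.Finite R S := Module.Finite.of_surjective (Algebra.linearMap R S) h.surjective
  refine forall_congr' fun i => ?_
  have e := (restrCHomologyIso (R := R) Y i).toLinearEquiv
  constructor
  · intro hf
    have h1 : Module.Finite R ((restr R S).obj (Y.homology i)) := Module.Finite.equiv e
    exact Module.Finite.of_restrictScalars_finite R S ((restr R S).obj (Y.homology i))
  · intro hf
    have h1 : Module.Finite S ((restr R S).obj (Y.homology i)) := hf
    have : Module.Finite R ((restr R S).obj (Y.homology i)) := Module.Finite.trans S _
    exact Module.Finite.equiv e.symm

end Bounded

/-- Models a long exact sequence `A^(i-2) → A^i → B^i → A^(i-1)`: in the lowest degree where `A` is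
nonzero the outer terms vanish, so `B` starts in the same degree. -/
theorem einf_eq_of_shift_two {A B : Set ℤ} (hA : BddBelow A) (h₁ : ∀ i ∈ B, i ∈ A ∨ i - 1 ∈ A)
    (h₂ : ∀ i ∈ A, i ∈ B ∨ i - 2 ∈ A) : einf A = einf B := by
  rcases A.eq_empty_or_nonempty with rfl | hne
  · have : B = ∅ := by
      ext i
      simpa using h₁ i
    rw [this]
  obtain ⟨d, hd⟩ := exists_isLeast_of_bddBelow hA hne
  have : IsLeast B d := by
    refine ⟨(h₂ d hd.1).resolve_right fun h => by have := hd.2 h; lia, fun i hi => ?_⟩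
    rcases h₁ i hi with hi | hi
    · exact hd.2 hi
    · have := hd.2 hi; lia
  rw [einf_eq_coe hd, einf_eq_coe this]

/-! ### Depth under change of rings from `R` to `R/xR` -/

section Depth

variable {R S : Type u} [CommRing R] [CommRing S] [Algebra R S]

instance projective_ext (M : ModuleCat.{u} R) [Projective M] : Projective ((ext R S).obj M) := by
  have : Module.Projective R M := (IsProjective.iff_projective M).2 inferInstance
  exact (IsProjective.iff_projective (R := S) (S ⊗[R] M)).1 inferInstance

theorem isStrictlyLE_extC (P : Cplx R) (n : ℤ) [P.IsStrictlyLE n] :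
    ((extC R S).obj P).IsStrictlyLE n := by
  rw [CochainComplex.isStrictlyLE_iff]
  intro i hi
  exact (ext R S).map_isZero (P.isZero_of_isStrictlyLE n i hi)

theorem isStrictlyLE_restrC (P : Cplx S) (n : ℤ) [P.IsStrictlyLE n] :
    ((restrC R S).obj P).IsStrictlyLE n := by
  rw [CochainComplex.isStrictlyLE_iff]
  intro i hi
  exact (restr R S).map_isZero (P.isZero_of_isStrictlyLE n i hi)

theorem isSMulRegular_of_projective {x : R} (hx : x ∈ nonZeroDivisors R) (M : ModuleCat.{u} R)
    [Projective M] : IsSMulRegular M x := by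
  have : Module.Projective R M := (IsProjective.iff_projective M).2 inferInstance
  exact Module.Flat.isSMulRegular_of_nonZeroDivisors hx

/-- Extension of scalars of the complex `R` is `S`. -/
def extCOfModuleIso : (extC R S).obj (ofModule R) ≅ ofModule S :=
  (HomologicalComplex.singleMapHomologicalComplex (ext R S) (ComplexShape.up ℤ) 0).app _ ≪≫
    (HomologicalComplex.single _ _ 0).mapIso (TensorProduct.AlgebraTensorModule.rid R S S).toModuleIso

variable [IsLocalRing R] [IsLocalRing S] {x : R} (h : IsQuotientBy R S x)
include h

/-- The residue field of a quotient of a local ring. -/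
theorem IsQuotientBy.nonempty_residueField_iso :
    Nonempty ((restr R S).obj (ModuleCat.of S (IsLocalRing.ResidueField S)) ≅
      ModuleCat.of R (IsLocalRing.ResidueField R)) := by
  let φ : R →+* IsLocalRing.ResidueField S := (IsLocalRing.residue S).comp (algebraMap R S)
  have hφ : Function.Surjective φ := IsLocalRing.residue_surjective.comp h.surjective
  have hker : RingHom.ker φ = IsLocalRing.maximalIdeal R :=
    IsLocalRing.eq_maximalIdeal (RingHom.ker_isMaximal_of_surjective φ hφ)
  let f : R →ₗ[R] ((restr R S).obj (ModuleCat.of S (IsLocalRing.ResidueField S))) :=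
    { toFun := φ
      map_add' := φ.map_add
      map_smul' := fun r s => by
        change φ (r * s) = _
        rw [map_mul]
        exact (Algebra.smul_def (algebraMap R S r) (φ s)).symm }
  have hf : LinearMap.ker f = IsLocalRing.maximalIdeal R := by
    rw [← hker]; ext r; rfl
  let e : (R ⧸ IsLocalRing.maximalIdeal R) ≃ₗ[R] _ :=
    (Submodule.quotEquivOfEq _ _ hf.symm).trans (f.quotKerEquivOfSurjective hφ)
  exact ⟨(show ModuleCat.of R (R ⧸ IsLocalRing.maximalIdeal R) ≅ _ from e.toModuleIso).symm⟩

theorem IsQuotientBy.nonempty_residueCplx_iso :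
    Nonempty ((restrC R S).obj (residueCplx S) ≅ residueCplx R) := by
  obtain ⟨e⟩ := h.nonempty_residueField_iso
  exact ⟨(HomologicalComplex.singleMapHomologicalComplex (restr R S) (ComplexShape.up ℤ) 0).app _ ≪≫
    (HomologicalComplex.single _ _ 0).mapIso e⟩

/-- Let `P` resolve `k` over `R`. Then `Ext_R(k, X)` is `Ext_S(S ⊗ P, X)`, and `S ⊗ P` is an
extension of `k` by a complex isomorphic to `k[1]` in `D(S)`. The resulting long exact sequence
relates `Ext_R^i(k, X)` to `Ext_S^i(k, X)` and `Ext_S^(i-1)(k, X)`, so the lowest nonzero degrees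
coincide. -/
theorem IsQuotientBy.depth_restrC (hx : x ∈ nonZeroDivisors R) (X : Cplx S)
    (hX : HasBoundedHomology X) : depth R ((restrC R S).obj X) = depth S X := by
  have : (residueCplx S).IsStrictlyLE 0 := by unfold residueCplx ofModule; infer_instance
  have := isStrictlyLE_restrC (R := R) (residueCplx S) 0
  obtain ⟨P, π, hπ, hπ', hP, hP'⟩ :=
    exists_epi_quasiIso_projective ((restrC R S).obj (residueCplx S)) 0
  obtain ⟨E, L, a, b, c, d, w, w', h₁, h₂, hE⟩ := exists_fourTerm h π hπ'
    fun i => isSMulRegular_of_projective hx (P.X i)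
  obtain ⟨e⟩ := h.nonempty_residueCplx_iso
  have : P.IsKProjective := CochainComplex.isKProjective_of_projective P (0 + 1)
  have := isStrictlyLE_extC (S := S) P (0 + 1)
  have : ∀ i, Projective (((extC R S).obj P).X i) := fun i => projective_ext (P.X i)
  have : ((extC R S).obj P).IsKProjective :=
    CochainComplex.isKProjective_of_projective ((extC R S).obj P) (0 + 1)
  have key : ∀ i, ExtVanishes (residueCplx R) ((restrC R S).obj X) i ↔
      ExtVanishes ((extC R S).obj P) X i := fun i => by
    rw [extVanishes_ext_iff, ExtVanishes.left_iff π hπ', ExtVanishes.left_iff e.hom inferInstance]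
  rw [depth_eq, depth_eq]
  symm
  apply einf_eq_of_shift_two (bddBelow_not_extVanishes X hX)
  · intro i hi
    by_contra! hc
    simp only [Set.mem_ofPred_eq, not_not, key] at hi hc
    exact hi (.src₂ h₂ (.src₃ h₁ (by lia) hc.2 (.of_acyclic_left hE)) hc.1)
  · intro i hi
    by_contra! hc
    simp only [Set.mem_ofPred_eq, not_not, key] at hi hc
    exact hi (.src₃ h₂ (i := i - 1) (by lia)
      (.src₃ h₁ (by lia) hc.2 (.of_acyclic_left hE)) hc.1)

theorem IsQuotientBy.hasBoundedHomology_extC (P : Cplx R) (hP : ∀ i, IsSMulRegular (P.X i) x)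
    (hP' : HasBoundedHomology P) : HasBoundedHomology ((extC R S).obj P) := by
  rw [← hasBoundedHomology_restrC_iff (R := R)]
  exact HasBoundedHomology.X₃ (h.shortExact_smul P hP) hP' hP'

theorem IsQuotientBy.hasFGHomology_extC [IsNoetherianRing R] (P : Cplx R)
    (hP : ∀ i, IsSMulRegular (P.X i) x)
    (hP' : HasFGHomology P) : HasFGHomology ((extC R S).obj P) := by
  rw [← h.hasFGHomology_restrC_iff]
  exact HasFGHomology.X₃ (h.shortExact_smul P hP) hP' hP'

theorem IsQuotientBy.depth_extC (hx : x ∈ nonZeroDivisors R) (hxm : x ∈ IsLocalRing.maximalIdeal R)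
    (P : Cplx R) (hP : ∀ i, IsSMulRegular (P.X i) x) (hP' : HasBoundedHomology P) :
    depth S ((extC R S).obj P) + 1 = depth R P := by
  rw [← h.depth_restrC hx _ (h.hasBoundedHomology_extC P hP hP')]
  exact depth_coker_smul hxm _ (h.shortExact_smul P hP)

theorem IsQuotientBy.depth_ofModule (hx : x ∈ nonZeroDivisors R)
    (hxm : x ∈ IsLocalRing.maximalIdeal R) : depth S (ofModule S) + 1 = depth R (ofModule R) := by
  rw [← h.depth_extC hx hxm (ofModule R) ?_ hasBoundedHomology_ofModule,
    depth_congr extCOfModuleIso.hom inferInstance]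
  intro i
  have : Projective ((ofModule (R := R) R).X i) := by
    by_cases hi : i = 0
    · subst hi
      have : Projective (ModuleCat.of R R) := (IsProjective.iff_projective R).1 inferInstance
      exact Projective.of_iso
        (HomologicalComplex.singleObjXSelf (ComplexShape.up ℤ) 0 (ModuleCat.of R R)).symm this
    · exact (HomologicalComplex.isZero_single_obj_X _ 0 (ModuleCat.of R R) i hi).projective
  exact isSMulRegular_of_projective hx _

end Depth

open HomologicalComplex

/-! ### Tensor products of complexes in bidegrees -/

section Tensor

variable {R : Type u} [CommRing R]

/-- The inclusion of a bihomogeneous component of the tensor product of two complexes. -/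
def tι (K L : Cplx R) (i j n : ℤ) (h : i + j = n) :
    ModuleCat.of R (K.X i ⊗[R] L.X j) ⟶ (tensorObj K L).X n :=
  ιTensorObj K L i j n h

theorem tensor_hom_ext {K L : Cplx R} {n : ℤ} {A : ModuleCat.{u} R}
    {f g : (tensorObj K L).X n ⟶ A}
    (h : ∀ i j (h : i + j = n), tι K L i j n h ≫ f = tι K L i j n h ≫ g) : f = g :=
  mapBifunctor.hom_ext h

/-- Morphisms out of the tensor product are determined by compatible morphisms on components. -/
def tDesc {K L : Cplx R} {n : ℤ} {A : ModuleCat.{u} R}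
    (f : ∀ i j (_ : i + j = n), ModuleCat.of R (K.X i ⊗[R] L.X j) ⟶ A) :
    (tensorObj K L).X n ⟶ A :=
  mapBifunctorDesc f

theorem tι_tDesc {K L : Cplx R} {n : ℤ} {A : ModuleCat.{u} R}
    (f : ∀ i j (_ : i + j = n), ModuleCat.of R (K.X i ⊗[R] L.X j) ⟶ A) (i j : ℤ) (h : i + j = n) :
    tι K L i j n h ≫ tDesc f = f i j h :=
  ι_mapBifunctorDesc (K₁ := K) (K₂ := L) (F := MonoidalCategory.curriedTensor (ModuleCat.{u} R))
    (c := ComplexShape.up ℤ) (A := A) (j := n) f i j h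

/-- The projection to a bihomogeneous component of the tensor product of two complexes. -/
def tπ (K L : Cplx R) (i j n : ℤ) (h : i + j = n) :
    (tensorObj K L).X n ⟶ ModuleCat.of R (K.X i ⊗[R] L.X j) :=
  tDesc fun i' j' h' => if e : i' = i then
    eqToHom (by obtain rfl : j' = j := by lia
                rw [e]) else 0

theorem tι_tπ (K L : Cplx R) (i j n : ℤ) (h : i + j = n) :
    tι K L i j n h ≫ tπ K L i j n h = 𝟙 _ := by
  rw [tπ, tι_tDesc, dif_pos rfl, eqToHom_refl]

theorem tι_tπ_of_ne (K L : Cplx R) (i j i' j' n : ℤ) (h : i + j = n) (h' : i' + j' = n)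
    (hi : i ≠ i') : tι K L i j n h ≫ tπ K L i' j' n h' = 0 := by
  rw [tπ, tι_tDesc, dif_neg hi]

theorem tι_tπ_assoc (K L : Cplx R) (i j n : ℤ) (h : i + j = n) {A : ModuleCat.{u} R}
    (f : ModuleCat.of R (K.X i ⊗[R] L.X j) ⟶ A) : tι K L i j n h ≫ tπ K L i j n h ≫ f = f := by
  rw [← Category.assoc, tι_tπ, Category.id_comp]

theorem tι_tπ_of_ne_assoc (K L : Cplx R) (i j i' j' n : ℤ) (h : i + j = n) (h' : i' + j' = n)
    (hi : i ≠ i') {A : ModuleCat.{u} R} (f : ModuleCat.of R (K.X i' ⊗[R] L.X j') ⟶ A) :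
    tι K L i j n h ≫ tπ K L i' j' n h' ≫ f = 0 := by
  rw [← Category.assoc, tι_tπ_of_ne _ _ _ _ _ _ _ _ _ hi, zero_comp]

theorem tι_tπ_apply (K L : Cplx R) (i j n : ℤ) (h : i + j = n) (t : K.X i ⊗[R] L.X j) :
    tπ K L i j n h (tι K L i j n h t) = t :=
  congr($(tι_tπ K L i j n h) t)

theorem tι_tπ_apply_of_ne (K L : Cplx R) (i j i' j' n : ℤ) (h : i + j = n) (h' : i' + j' = n)
    (hi : i ≠ i') (t : K.X i ⊗[R] L.X j) :
    tπ K L i' j' n h' (tι K L i j n h t) = 0 :=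
  congr($(tι_tπ_of_ne K L i j i' j' n h h' hi) t)

theorem iSup_range_tι (K L : Cplx R) (n : ℤ) :
    ⨆ i : ℤ, LinearMap.range (tι K L i (n - i) n (by lia)).hom = ⊤ := by
  set N := ⨆ i : ℤ, LinearMap.range (tι K L i (n - i) n (by lia)).hom
  have : ModuleCat.ofHom N.mkQ = 0 := by
    apply tensor_hom_ext
    intro i j h
    obtain rfl : j = n - i := by lia
    ext1
    refine LinearMap.ext fun t => ?_
    exact (Submodule.Quotient.mk_eq_zero N).2
      (Submodule.mem_iSup_of_mem i (LinearMap.mem_range_self _ t))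
  rw [← Submodule.ker_mkQ N]
  exact LinearMap.ker_eq_top.2 congr(($this).hom)

/-- The total complex is a direct sum, so elements have finite support. Allowing every larger `s'`
lets several elements share one index set. -/
theorem exists_finset_sum_tπ {K L : Cplx R} {n : ℤ} (z : (tensorObj K L).X n) :
    ∃ s : Finset ℤ, ∀ s', s ⊆ s' → z =
      ∑ i ∈ s', tι K L i (n - i) n (by lia) (tπ K L i (n - i) n (by lia) z) := by
  classical
  have hz : z ∈ ⨆ i : ℤ, LinearMap.range (tι K L i (n - i) n (by lia)).hom := by
    rw [iSup_range_tι]; trivial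
  induction hz using Submodule.iSup_induction' with
  | mem i z hz =>
    obtain ⟨t, rfl⟩ := hz
    refine ⟨{i}, fun s' hs' => ?_⟩
    rw [Finset.sum_eq_single i]
    · exact (congrArg _ (tι_tπ_apply K L i (n - i) n (by lia) t)).symm
    · intro j _ hj
      exact (congrArg _ (tι_tπ_apply_of_ne K L i (n - i) j (n - j) n (by lia) (by lia) hj.symm
        t)).trans (map_zero _)
    · intro hi
      exact absurd (hs' (Finset.mem_singleton_self i)) hi
  | zero => exact ⟨∅, fun s' _ => by simp⟩
  | add a b _ _ ha hb =>
    obtain ⟨s, hs⟩ := ha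
    obtain ⟨t, ht⟩ := hb
    refine ⟨s ∪ t, fun s' hs' => ?_⟩
    simp only [map_add, Finset.sum_add_distrib]
    rw [← hs s' (Finset.union_subset_left hs'), ← ht s' (Finset.union_subset_right hs')]

theorem tensor_elt_ext {K L : Cplx R} {n : ℤ} {z z' : (tensorObj K L).X n}
    (h : ∀ i j (h : i + j = n), tπ K L i j n h z = tπ K L i j n h z') : z = z' := by
  obtain ⟨s, hs⟩ := exists_finset_sum_tπ z
  obtain ⟨s', hs'⟩ := exists_finset_sum_tπ z'
  rw [hs _ (Finset.subset_union_left (s₂ := s')), hs' _ (Finset.subset_union_right (s₁ := s))]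
  exact Finset.sum_congr rfl fun i _ => by rw [h]

theorem exists_finset_tπ_eq_zero {K L : Cplx R} {n : ℤ} (z : (tensorObj K L).X n) :
    ∃ s : Finset ℤ, ∀ i j (h : i + j = n), i ∉ s → tπ K L i j n h z = 0 := by
  obtain ⟨s, hs⟩ := exists_finset_sum_tπ z
  refine ⟨s, fun i j h hi => ?_⟩
  rw [hs s subset_rfl, map_sum]
  exact Finset.sum_eq_zero fun i' hi' => tι_tπ_apply_of_ne K L i' (n - i') i j n (by lia) h
    (fun he => hi (he ▸ hi')) _

section Map

variable {K K' L L' : Cplx R} (f : K ⟶ K') (g : L ⟶ L')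

/-- The tensor product of two morphisms of complexes in a given bidegree. -/
def tMap (i j : ℤ) : ModuleCat.of R (K.X i ⊗[R] L.X j) ⟶ ModuleCat.of R (K'.X i ⊗[R] L'.X j) :=
  ModuleCat.ofHom (TensorProduct.map (f.f i).hom (g.f j).hom)

theorem tι_tensorHom (i j n : ℤ) (h : i + j = n) :
    tι K L i j n h ≫ (tensorHom f g).f n = tMap f g i j ≫ tι K' L' i j n h := by
  refine (ι_mapBifunctorMap f g _ _ i j n h).trans ?_
  rw [← Category.assoc]
  congr 1
  apply ModuleCat.hom_ext
  apply TensorProduct.ext'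
  intro x y
  rfl

theorem tensorHom_tι (i j n : ℤ) (h : i + j = n) (t : K.X i ⊗[R] L.X j) :
    (tensorHom f g).f n (tι K L i j n h t) = tι K' L' i j n h (tMap f g i j t) :=
  congr($(tι_tensorHom f g i j n h) t)

theorem tensorHom_tπ (i j n : ℤ) (h : i + j = n) :
    (tensorHom f g).f n ≫ tπ K' L' i j n h = tπ K L i j n h ≫ tMap f g i j := by
  apply tensor_hom_ext
  intro i' j' h'
  rw [← Category.assoc, ← Category.assoc, tι_tensorHom, Category.assoc]
  by_cases hi : i' = i
  · subst hi
    obtain rfl : j' = j := by lia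
    rw [tι_tπ, tι_tπ, Category.id_comp, Category.comp_id]
  · rw [tι_tπ_of_ne _ _ _ _ _ _ _ _ _ hi, tι_tπ_of_ne _ _ _ _ _ _ _ _ _ hi, zero_comp, comp_zero]

theorem tπ_tensorHom (i j n : ℤ) (h : i + j = n) (z : (tensorObj K L).X n) :
    tπ K' L' i j n h ((tensorHom f g).f n z) = tMap f g i j (tπ K L i j n h z) :=
  congr($(tensorHom_tπ f g i j n h) z)

end Map

theorem shortExact_tensor {K K' K'' L L' L'' : Cplx R} (f : K ⟶ K') (f' : K' ⟶ K'') (g : L ⟶ L')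
    (g' : L' ⟶ L'') (w : tensorHom f g ≫ tensorHom f' g' = 0)
    (h₁ : ∀ i j, Function.Injective (tMap f g i j))
    (h₂ : ∀ i j, Function.Exact (tMap f g i j) (tMap f' g' i j))
    (h₃ : ∀ i j, Function.Surjective (tMap f' g' i j)) :
    (ShortComplex.mk _ _ w).ShortExact := by
  apply shortExact_of_forall
  · intro n z z' hz
    apply tensor_elt_ext
    intro i j h
    apply h₁
    rw [← tπ_tensorHom, ← tπ_tensorHom]
    exact congrArg _ hz
  · intro n z
    refine ⟨fun hz => ?_, ?_⟩
    · have hc : ∀ i, ∃ t, tMap f g i (n - i) t = tπ K' L' i (n - i) n (by lia) z := fun i =>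
        (h₂ i (n - i) _).1 (by
          rw [← tπ_tensorHom]
          exact (congrArg _ hz).trans (map_zero _))
      choose t ht using hc
      obtain ⟨s, hs⟩ := exists_finset_sum_tπ z
      refine ⟨∑ i ∈ s, tι K L i (n - i) n (by lia) (t i), ?_⟩
      rw [map_sum, hs s subset_rfl]
      exact Finset.sum_congr rfl fun i _ => (tensorHom_tι f g _ _ _ _ _).trans (by rw [ht])
    · rintro ⟨z, rfl⟩
      exact congr(($w).f n z)
  · intro n z
    choose t ht using fun i => h₃ i (n - i) (tπ K'' L'' i (n - i) n (by lia) z)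
    obtain ⟨s, hs⟩ := exists_finset_sum_tπ z
    refine ⟨∑ i ∈ s, tι K' L' i (n - i) n (by lia) (t i), ?_⟩
    rw [map_sum, hs s subset_rfl]
    exact Finset.sum_congr rfl fun i _ => (tensorHom_tι f' g' _ _ _ _ _).trans (by rw [ht])

/-- The sign of the second differential. -/
def tSign (i j : ℤ) : ℤˣ := ComplexShape.ε₂ (ComplexShape.up ℤ) (ComplexShape.up ℤ)
  (ComplexShape.up ℤ) (i, j)

theorem tι_d (K L : Cplx R) (i j n : ℤ) (h : i + j = n) :
    tι K L i j n h ≫ (tensorObj K L).d n (n + 1) =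
      ModuleCat.ofHom ((K.d i (i + 1)).hom.rTensor (L.X j)) ≫
          tι K L (i + 1) j (n + 1) (by lia) +
        tSign i j • (ModuleCat.ofHom ((L.d j (j + 1)).hom.lTensor (K.X i)) ≫
          tι K L i (j + 1) (n + 1) (by lia)) := by
  have h1 := mapBifunctor.d₁_eq K L (MonoidalCategory.curriedTensor (ModuleCat.{u} R))
    (ComplexShape.up ℤ) (i₁ := i) (i₁' := i + 1) rfl j (n + 1)
    (by dsimp [ComplexShape.π]; lia)
  have h2 := mapBifunctor.d₂_eq K L (MonoidalCategory.curriedTensor (ModuleCat.{u} R))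
    (ComplexShape.up ℤ) i (i₂ := j) (i₂' := j + 1) rfl (n + 1)
    (by dsimp [ComplexShape.π]; lia)
  have h3 : tι K L i j n h ≫ (tensorObj K L).d n (n + 1) =
      mapBifunctor.d₁ K L (MonoidalCategory.curriedTensor (ModuleCat.{u} R))
        (ComplexShape.up ℤ) i j (n + 1) +
      mapBifunctor.d₂ K L (MonoidalCategory.curriedTensor (ModuleCat.{u} R))
        (ComplexShape.up ℤ) i j (n + 1) := by
    rw [mapBifunctor.d_eq, Preadditive.comp_add]
    exact congr($(mapBifunctor.ι_D₁ K L (MonoidalCategory.curriedTensor (ModuleCat.{u} R))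
      (ComplexShape.up ℤ) n (n + 1) i j h) +
      $(mapBifunctor.ι_D₂ K L (MonoidalCategory.curriedTensor (ModuleCat.{u} R))
      (ComplexShape.up ℤ) n (n + 1) i j h))
  rw [h3, h1, h2]
  congr 1
  exact one_smul _ _

theorem d_tι (K L : Cplx R) (i j n : ℤ) (h : i + j = n) (t : K.X i ⊗[R] L.X j) :
    (tensorObj K L).d n (n + 1) (tι K L i j n h t) =
      tι K L (i + 1) j (n + 1) (by lia) ((K.d i (i + 1)).hom.rTensor (L.X j) t) +
        tSign i j • tι K L i (j + 1) (n + 1) (by lia) ((L.d j (j + 1)).hom.lTensor (K.X i) t) := by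
  exact congr($(tι_d K L i j n h) t)

theorem d_tπ (K L : Cplx R) (i j n : ℤ) (h : i + 1 + j = n) :
    (tensorObj K L).d n (n + 1) ≫ tπ K L (i + 1) (j + 1) (n + 1) (by lia) =
      tπ K L i (j + 1) n (by lia) ≫ ModuleCat.ofHom ((K.d i (i + 1)).hom.rTensor (L.X (j + 1))) +
        tSign (i + 1) j • (tπ K L (i + 1) j n h ≫
          ModuleCat.ofHom ((L.d j (j + 1)).hom.lTensor (K.X (i + 1)))) := by
  apply tensor_hom_ext
  intro i' j' h'
  rw [← Category.assoc, tι_d]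
  simp only [Preadditive.add_comp, Preadditive.comp_add, Category.assoc,
    Linear.units_smul_comp, Linear.comp_units_smul]
  by_cases h₀ : i' = i
  · subst h₀
    obtain rfl : j' = j + 1 := by omega
    rw [tι_tπ, tι_tπ_of_ne _ _ _ _ _ _ _ _ _ (show i' ≠ i' + 1 by omega), tι_tπ_assoc,
      tι_tπ_of_ne_assoc _ _ _ _ _ _ _ _ _ (show i' ≠ i' + 1 by omega)]
    simp
  by_cases h₁ : i' = i + 1
  · subst h₁
    obtain rfl : j' = j := by omega
    rw [tι_tπ, tι_tπ_of_ne _ _ _ _ _ _ _ _ _ (show i + 1 + 1 ≠ i + 1 by omega), tι_tπ_assoc,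
      tι_tπ_of_ne_assoc _ _ _ _ _ _ _ _ _ (show i + 1 ≠ i by omega)]
    simp
  · rw [tι_tπ_of_ne _ _ _ _ _ _ _ _ _ (show i' + 1 ≠ i + 1 by omega),
      tι_tπ_of_ne _ _ _ _ _ _ _ _ _ (show i' ≠ i + 1 by omega),
      tι_tπ_of_ne_assoc _ _ _ _ _ _ _ _ _ (show i' ≠ i by omega),
      tι_tπ_of_ne_assoc _ _ _ _ _ _ _ _ _ (show i' ≠ i + 1 by omega)]
    simp

theorem tπ_d (K L : Cplx R) (i j n : ℤ) (h : i + 1 + j = n) (z : (tensorObj K L).X n) :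
    tπ K L (i + 1) (j + 1) (n + 1) (by lia) ((tensorObj K L).d n (n + 1) z) =
      (K.d i (i + 1)).hom.rTensor (L.X (j + 1)) (tπ K L i (j + 1) n (by lia) z) +
        tSign (i + 1) j • (L.d j (j + 1)).hom.lTensor (K.X (i + 1)) (tπ K L (i + 1) j n h z) :=
  congr($(d_tπ K L i j n h) z)

/-- A cycle of `P ⊗ A` supported in first degrees `> b - k` is a boundary. -/
theorem exists_d_eq_of_tπ_eq_zero {P A : Cplx R} (b : ℤ) [P.IsStrictlyLE b]
    (hP : ∀ i, Module.Flat R (P.X i)) (hA : A.Acyclic) (k : ℕ) (n : ℤ)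
    (z : (tensorObj P A).X (n + 1)) (hz : (tensorObj P A).d (n + 1) (n + 1 + 1) z = 0)
    (hk : ∀ i j (h : i + j = n + 1), i ≤ b - k → tπ P A i j (n + 1) h z = 0) :
    ∃ w, (tensorObj P A).d n (n + 1) w = z := by
  induction k generalizing z with
  | zero =>
    refine ⟨0, (map_zero _).trans (tensor_elt_ext fun i j h => ?_)⟩
    rw [map_zero]
    by_cases hi : i ≤ b
    · exact (hk i j h (by simpa using hi)).symm
    · have := ModuleCat.subsingleton_of_isZero
        (P.isZero_of_isStrictlyLE b i (show b < i by omega))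
      have : Subsingleton (P.X i ⊗[R] A.X j) := inferInstance
      exact Subsingleton.elim _ _
  | succ k ih =>
    push_cast at hk
    -- `i + 1` is the lowest first degree in which `z` may be nonzero. There the differential of `P`
    -- contributes nothing to `d z`, so this component is a cycle for the differential of `A`.
    -- Flatness lifts it to `t`, and subtracting the boundary `d w` leaves a cycle supported in
    -- higher first degrees.
    obtain ⟨i, hi⟩ : ∃ i : ℤ, i + 1 = b - k := ⟨b - k - 1, by omega⟩
    obtain ⟨j, hj⟩ : ∃ j : ℤ, i + 1 + (j + 1) = n + 1 := ⟨n - 1 - i, by omega⟩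
    have h1 := tπ_d P A i (j + 1) (n + 1) hj z
    rw [hz, hk i _ _ (by omega), map_zero, map_zero, zero_add] at h1
    have h2 : (A.d (j + 1) (j + 1 + 1)).hom.lTensor (P.X (i + 1))
        (tπ P A (i + 1) (j + 1) (n + 1) hj z) = 0 := by
      have := congrArg (fun t => (tSign (i + 1) (j + 1))⁻¹ • t) h1.symm
      rw [inv_smul_smul, smul_zero] at this
      exact this
    have hA' : Function.Exact (A.d j (j + 1)).hom (A.d (j + 1) (j + 1 + 1)).hom := by
      have := (exactAt_iff_exact A (j + 1)).1 (hA (j + 1))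
      rw [add_sub_cancel_right] at this
      exact this
    have := hP (i + 1)
    obtain ⟨t, ht⟩ := (Module.Flat.lTensor_exact (P.X (i + 1)) hA' _).1 h2
    have hij : i + 1 + j = n := by omega
    let w := tι P A (i + 1) j n hij ((tSign (i + 1) j)⁻¹ • t)
    have hw : (tensorObj P A).d n (n + 1) w = _ := d_tι P A (i + 1) j n hij _
    have hdw : (tensorObj P A).d (n + 1) (n + 1 + 1) ((tensorObj P A).d n (n + 1) w) = 0 :=
      congr($((tensorObj P A).d_comp_d n (n + 1) (n + 1 + 1)) w)
    have hπ : ∀ i' j' (h : i' + j' = n + 1), i' ≤ b - k →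
        tπ P A i' j' (n + 1) h (z - (tensorObj P A).d n (n + 1) w) = 0 := by
      intro i' j' h' hi'
      rw [map_sub, sub_eq_zero, hw, map_add,
        tι_tπ_apply_of_ne _ _ _ _ _ _ _ _ _ (show i + 1 + 1 ≠ i' by omega), zero_add]
      by_cases hii : i' = i + 1
      · subst hii
        obtain rfl : j' = j + 1 := by omega
        rw [Units.smul_def, map_zsmul, tι_tπ_apply, ← Units.smul_def, Units.smul_def _ t,
          map_zsmul, ht, ← Units.smul_def, smul_inv_smul]
      · rw [Units.smul_def, map_zsmul,
          tι_tπ_apply_of_ne _ _ _ _ _ _ _ _ _ (show i + 1 ≠ i' by omega), smul_zero]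
        exact hk i' j' h' (by omega)
    obtain ⟨w', hw'⟩ := ih (z - (tensorObj P A).d n (n + 1) w)
      (by rw [map_sub, hz, hdw, sub_zero]) hπ
    exact ⟨w' + w, by rw [map_add, hw', sub_add_cancel]⟩

/-- By finite support, every cycle vanishes in sufficiently low first degrees, so the inductive
statement above applies for a suitable `k`. -/
theorem acyclic_tensorObj {P A : Cplx R} (b : ℤ) [P.IsStrictlyLE b]
    (hP : ∀ i, Module.Flat R (P.X i)) (hA : A.Acyclic) : (tensorObj P A).Acyclic := by
  intro n
  obtain ⟨n, rfl⟩ : ∃ m, n = m + 1 := ⟨n - 1, by lia⟩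
  rw [exactAt_iff_exact, add_sub_cancel_right]
  intro z
  refine ⟨fun hz => ?_, ?_⟩
  · obtain ⟨s, hs⟩ := exists_finset_tπ_eq_zero z
    obtain ⟨m, hm⟩ := s.bddBelow
    refine exists_d_eq_of_tπ_eq_zero b hP hA (b - m + 1).toNat n z hz fun i j h hi => hs i j h ?_
    intro his
    have : m ≤ i := hm his
    omega
  · rintro ⟨w, rfl⟩
    exact congr($((tensorObj P A).d_comp_d n (n + 1) (n + 1 + 1)) w)

end Tensor

/-! ### Exactness and quasi-isomorphisms under tensor products -/

section Exactness

variable {R : Type u} [CommRing R]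

section

attribute [local instance] HasDerivedCategory.standard

variable {S : ShortComplex (Cplx R)} (hS : S.ShortExact)
include hS

theorem quasiIso_g_of_acyclic (h : S.X₁.Acyclic) : QuasiIso S.g := by
  rw [← DerivedCategory.isIso_Q_map_iff_quasiIso]
  exact (Triangle.isZero₁_iff_isIso₂ _ (DerivedCategory.triangleOfSES_distinguished hS)).1
    (isZero_Q_obj_of_acyclic h)

theorem quasiIso_f_of_acyclic (h : S.X₃.Acyclic) : QuasiIso S.f := by
  rw [← DerivedCategory.isIso_Q_map_iff_quasiIso]
  exact (Triangle.isZero₃_iff_isIso₁ _ (DerivedCategory.triangleOfSES_distinguished hS)).1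
    (isZero_Q_obj_of_acyclic h)

end

theorem tensorHom_comp_eq_zero {K K' K'' L L' L'' : Cplx R} {f : K ⟶ K'} {f' : K' ⟶ K''}
    {g : L ⟶ L'} {g' : L' ⟶ L''} (h : f ≫ f' = 0 ∨ g ≫ g' = 0) :
    tensorHom f g ≫ tensorHom f' g' = 0 := by
  ext1 n
  apply tensor_hom_ext
  intro i j hij
  rw [comp_f, ← Category.assoc, tι_tensorHom, Category.assoc, tι_tensorHom, ← Category.assoc]
  have : tMap f g i j ≫ tMap f' g' i j = 0 := by
    apply ModuleCat.hom_ext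
    apply TensorProduct.ext'
    intro a b
    change (f'.f i (f.f i a)) ⊗ₜ[R] (g'.f j (g.f j b)) = 0
    rcases h with h | h
    · have : f'.f i (f.f i a) = 0 := congr(($h).f i a)
      rw [this, zero_tmul]
    · have : g'.f j (g.f j b) = 0 := congr(($h).f j b)
      rw [this, tmul_zero]
  rw [this, zero_comp]
  rfl

/-- Tensoring a short exact sequence with a complex of flat modules. -/
theorem shortExact_tensor_left (P : Cplx R) (hP : ∀ i, Module.Flat R (P.X i))
    {X Y Z : Cplx R} {f : X ⟶ Y} {g : Y ⟶ Z} {w : f ≫ g = 0}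
    (hS : (ShortComplex.mk f g w).ShortExact) :
    (ShortComplex.mk (tensorHom (𝟙 P) f) (tensorHom (𝟙 P) g)
      (tensorHom_comp_eq_zero (Or.inr w))).ShortExact := by
  apply shortExact_tensor
  · intro i j
    have := hP i
    exact Module.Flat.lTensor_preserves_injective_linearMap (M := P.X i) _
      (injective_f_of_shortExact hS j)
  · intro i j
    have := hP i
    exact Module.Flat.lTensor_exact (P.X i) (exact_of_shortExact hS j)
  · intro i j
    exact LinearMap.lTensor_surjective (P.X i) (surjective_g_of_shortExact hS j)

theorem injective_rTensor_of_leftInverse {A B : Type u} [AddCommGroup A] [AddCommGroup B] [Module R A]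
    [Module R B] (f : A →ₗ[R] B) (r : B →ₗ[R] A) (h : r ∘ₗ f = LinearMap.id) (N : Type u)
    [AddCommGroup N] [Module R N] : Function.Injective (f.rTensor N) := by
  apply Function.LeftInverse.injective (g := r.rTensor N)
  intro t
  rw [← LinearMap.comp_apply, ← LinearMap.rTensor_comp, h, LinearMap.rTensor_id]
  rfl

/-- Tensoring a degreewise split short exact sequence. -/
theorem shortExact_tensor_right (N : Cplx R) {X Y Z : Cplx R} {f : X ⟶ Y} {g : Y ⟶ Z}
    {w : f ≫ g = 0} (hS : (ShortComplex.mk f g w).ShortExact) (hZ : ∀ i, Projective (Z.X i)) :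
    (ShortComplex.mk (tensorHom f (𝟙 N)) (tensorHom g (𝟙 N))
      (tensorHom_comp_eq_zero (Or.inl w))).ShortExact := by
  apply shortExact_tensor
  · intro i j
    have hi := shortExact_eval hS i
    have : Projective ((ShortComplex.mk f g w).map (eval _ _ i)).X₃ := hZ i
    have hr : f.f i ≫ hi.splittingOfProjective.r = 𝟙 _ := hi.splittingOfProjective.f_r
    exact injective_rTensor_of_leftInverse (f.f i).hom hi.splittingOfProjective.r.hom
      congr(($hr).hom) (N.X j)
  · intro i j
    exact rTensor_exact (N.X j) (exact_of_shortExact hS i) (surjective_g_of_shortExact hS i)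
  · intro i j
    exact LinearMap.rTensor_surjective (N.X j) (surjective_g_of_shortExact hS i)

theorem projective_X₁ {S : ShortComplex (Cplx R)} (hS : S.ShortExact)
    (h₂ : ∀ i, Projective (S.X₂.X i)) (h₃ : ∀ i, Projective (S.X₃.X i)) (i : ℤ) :
    Projective (S.X₁.X i) := by
  have hi := shortExact_eval hS i
  have : Projective (S.map (eval _ _ i)).X₃ := h₃ i
  have : Projective (S.map (eval _ _ i)).X₂ := h₂ i
  exact (Retract.mk (S.f.f i) hi.splittingOfProjective.r
    hi.splittingOfProjective.f_r).projective

theorem projective_X₂ {S : ShortComplex (Cplx R)} (hS : S.ShortExact)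
    (h₁ : ∀ i, Projective (S.X₁.X i)) (h₃ : ∀ i, Projective (S.X₃.X i)) (i : ℤ) :
    Projective (S.X₂.X i) := by
  have hi := shortExact_eval hS i
  have : Projective (S.map (eval _ _ i)).X₃ := h₃ i
  have : Projective (S.map (eval _ _ i)).X₁ := h₁ i
  exact Projective.of_iso hi.splittingOfProjective.isoBinaryBiproduct.symm inferInstance

section

variable {P : Cplx R} (b : ℤ) [P.IsStrictlyLE b] (hP : ∀ i, Module.Flat R (P.X i))
  {M N : Cplx R} (f : M ⟶ N)
include b hP

theorem quasiIso_tensorHom_of_epi [Epi f] (hf : QuasiIso f) :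
    QuasiIso (tensorHom (𝟙 P) f) :=
  have hS := shortExact_kernel f
  quasiIso_g_of_acyclic (shortExact_tensor_left P hP hS)
    (acyclic_tensorObj b hP (hS.acyclic_X₁ hf))

theorem quasiIso_tensorHom_of_mono [Mono f] (hf : QuasiIso f) :
    QuasiIso (tensorHom (𝟙 P) f) :=
  have hS := shortExact_cokernel f
  quasiIso_f_of_acyclic (shortExact_tensor_left P hP hS)
    (acyclic_tensorObj b hP (hS.acyclic_X₃ hf))

end

/-- A bounded above acyclic complex of projectives stays acyclic after tensoring. -/
theorem acyclic_tensorObj_of_projective (E N : Cplx R) (b : ℤ) [E.IsStrictlyLE b]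
    (hE : ∀ i, Projective (E.X i)) (hE' : E.Acyclic) : (tensorObj E N).Acyclic := by
  have : E.IsKProjective := CochainComplex.isKProjective_of_projective E b
  -- `E` is contractible, being acyclic and K-projective; tensoring the contraction works for
  -- arbitrary `N`, with no flatness or boundedness.
  have h := mapBifunctorMapHomotopy₁ (CochainComplex.IsKProjective.homotopyZero (𝟙 E) hE') (𝟙 N)
    (MonoidalCategory.curriedTensor (ModuleCat.{u} R)) (ComplexShape.up ℤ)
  have h1 : tensorHom (𝟙 E) (𝟙 N) = 𝟙 (tensorObj E N) := by
    ext1 n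
    apply tensor_hom_ext
    intro i j hij
    rw [tι_tensorHom]
    have : tMap (𝟙 E) (𝟙 N) i j = 𝟙 _ := by
      apply ModuleCat.hom_ext
      apply TensorProduct.ext'
      intro a b
      rfl
    rw [this, Category.id_comp]
    exact (Category.comp_id _).symm
  have h2 : tensorHom (0 : E ⟶ E) (𝟙 N) = 0 := by
    ext1 n
    apply tensor_hom_ext
    intro i j hij
    rw [tι_tensorHom]
    have : tMap (0 : E ⟶ E) (𝟙 N) i j = 0 := by
      apply ModuleCat.hom_ext
      apply TensorProduct.ext'
      intro a b
      exact zero_tmul _ _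
    rw [this, zero_comp]
    exact comp_zero.symm
  intro i
  rw [exactAt_iff_isZero_homology, IsZero.iff_id_eq_zero, ← homologyMap_id, ← h1]
  refine (h.homologyMap_eq i).trans ?_
  exact (congrArg (fun f => homologyMap f i) h2).trans (homologyMap_zero _ _ i)

end Exactness

/-! ### The isomorphism `P ⊗_R N ≅ (S ⊗_R P) ⊗_S N` -/

section BaseChange

variable {R S : Type u} [CommRing R] [CommRing S] [Algebra R S]

variable (S) in
/-- The isomorphism `p ⊗ n ↦ (1 ⊗ p) ⊗ n`. -/
def tensorBaseChangeEquiv (M N : Type u) [AddCommGroup M] [Module R M] [AddCommGroup N] [Module R N]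
    [Module S N] [IsScalarTower R S N] : M ⊗[R] N ≃+ (S ⊗[R] M) ⊗[S] N :=
  (TensorProduct.comm R M N).toAddEquiv.trans
    ((AlgebraTensorModule.cancelBaseChange R S S N M).symm.toAddEquiv.trans
      (TensorProduct.comm S N (S ⊗[R] M)).toAddEquiv)

theorem tensorBaseChangeEquiv_tmul {M N : Type u} [AddCommGroup M] [Module R M] [AddCommGroup N]
    [Module R N] [Module S N] [IsScalarTower R S N] (m : M) (n : N) :
    tensorBaseChangeEquiv S M N (m ⊗ₜ n) = ((1 : S) ⊗ₜ[R] m) ⊗ₜ[S] n := by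
  simp [tensorBaseChangeEquiv]

theorem tensorBaseChangeEquiv_smul {M N : Type u} [AddCommGroup M] [Module R M] [AddCommGroup N]
    [Module R N] [Module S N] [IsScalarTower R S N] (r : R) (t : M ⊗[R] N) :
    tensorBaseChangeEquiv S M N (r • t) = algebraMap R S r • tensorBaseChangeEquiv S M N t := by
  induction t using TensorProduct.induction_on with
  | zero => simp
  | add a b ha hb => rw [smul_add, map_add, map_add, ha, hb, smul_add]
  | tmul m n =>
    rw [← tmul_smul, tensorBaseChangeEquiv_tmul, tensorBaseChangeEquiv_tmul, ← tmul_smul,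
      algebraMap_smul]

/-- The map `p ⊗ n ↦ (1 ⊗ p) ⊗ n`. -/
def tComp (M : ModuleCat.{u} R) (N : ModuleCat.{u} S) :
    ModuleCat.of R (M ⊗[R] ((restr R S).obj N)) ⟶
      (restr R S).obj (ModuleCat.of S (((ext R S).obj M) ⊗[S] N)) :=
  ModuleCat.ofHom (Y := (restr R S).obj (ModuleCat.of S (((ext R S).obj M) ⊗[S] N)))
    { toFun := tensorBaseChangeEquiv S M ((restr R S).obj N)
      map_add' := map_add _
      map_smul' := fun r t => tensorBaseChangeEquiv_smul r t }

theorem tComp_tmul (M : ModuleCat.{u} R) (N : ModuleCat.{u} S) (m : M) (n : N) :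
    tComp (R := R) M N (TensorProduct.tmul R (N := (restr R S).obj N) m n) =
      ((1 : S) ⊗ₜ[R] m : S ⊗[R] M) ⊗ₜ[S] n :=
  tensorBaseChangeEquiv_tmul (N := (restr R S).obj N) m n

theorem tComp_bijective (M : ModuleCat.{u} R) (N : ModuleCat.{u} S) :
    Function.Bijective (tComp (R := R) M N) :=
  (tensorBaseChangeEquiv S M ((restr R S).obj N)).bijective

variable (P : Cplx R) (N : Cplx S)

/-- The map `p ⊗ n ↦ (1 ⊗ p) ⊗ n` in a given bidegree. -/
def tCompC (i j : ℤ) : ModuleCat.of R (P.X i ⊗[R] ((restrC R S).obj N).X j) ⟶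
    (restr R S).obj (ModuleCat.of S (((extC R S).obj P).X i ⊗[S] N.X j)) :=
  tComp (P.X i) (N.X j)

theorem tCompC_bijective (i j : ℤ) : Function.Bijective (tCompC P N i j) :=
  tComp_bijective (P.X i) (N.X j)

/-- The components of the comparison map. -/
def baseChangeX (n : ℤ) : (tensorObj P ((restrC R S).obj N)).X n ⟶
    (restr R S).obj ((tensorObj ((extC R S).obj P) N).X n) :=
  tDesc fun i j h => tCompC P N i j ≫ (restr R S).map (tι ((extC R S).obj P) N i j n h)

theorem baseChangeX_tι (i j n : ℤ) (h : i + j = n) (t : P.X i ⊗[R] ((restr R S).obj (N.X j))) :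
    baseChangeX P N n (tι P ((restrC R S).obj N) i j n h t) =
      tι ((extC R S).obj P) N i j n h (tCompC P N i j t) :=
  congr($(tι_tDesc (K := P) (L := (restrC R S).obj N) (fun i j h => tCompC P N i j ≫
    (restr R S).map (tι ((extC R S).obj P) N i j n h)) i j h) t)

theorem baseChangeX_comm (n : ℤ) :
    baseChangeX P N n ≫ (restr R S).map ((tensorObj ((extC R S).obj P) N).d n (n + 1)) =
      (tensorObj P ((restrC R S).obj N)).d n (n + 1) ≫ baseChangeX P N (n + 1) := by
  apply tensor_hom_ext
  intro i j h
  apply ModuleCat.hom_ext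
  apply TensorProduct.ext'
  intro p q
  change (tensorObj ((extC R S).obj P) N).d n (n + 1)
      (baseChangeX P N n (tι P ((restrC R S).obj N) i j n h (p ⊗ₜ q))) =
    baseChangeX P N (n + 1) ((tensorObj P ((restrC R S).obj N)).d n (n + 1)
      (tι P ((restrC R S).obj N) i j n h (p ⊗ₜ q)))
  have e1 := congrArg ((tensorObj ((extC R S).obj P) N).d n (n + 1))
    (baseChangeX_tι P N i j n h (p ⊗ₜ q))
  have e2 := d_tι ((extC R S).obj P) N i j n h (tCompC P N i j (p ⊗ₜ q))
  have e3 := congrArg (baseChangeX P N (n + 1))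
    (d_tι P ((restrC R S).obj N) i j n h (p ⊗ₜ q))
  refine (e1.trans e2).trans (Eq.trans ?_ e3.symm)
  have e4 := baseChangeX_tι P N (i + 1) j (n + 1) (by omega)
    ((P.d i (i + 1)).hom.rTensor ((restr R S).obj (N.X j)) (p ⊗ₜ q))
  have e5 := baseChangeX_tι P N i (j + 1) (n + 1) (by omega)
    ((((restrC R S).obj N).d j (j + 1)).hom.lTensor (P.X i) (p ⊗ₜ q))
  refine Eq.trans ?_ (map_add _ _ _).symm
  refine congrArg₂ (· + ·) (Eq.trans ?_ e4.symm) ?_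
  · refine congrArg (tι ((extC R S).obj P) N (i + 1) j (n + 1) (by omega)) ?_
    refine (congrArg _ (tComp_tmul (P.X i) (N.X j) p q)).trans ?_
    exact (tComp_tmul (P.X (i + 1)) (N.X j) (P.d i (i + 1) p) q).symm
  · rw [Units.smul_def, Units.smul_def]
    refine Eq.trans ?_ (map_zsmul (baseChangeX P N (n + 1)).hom _ _).symm
    refine congrArg _ (Eq.trans ?_ e5.symm)
    refine congrArg (tι ((extC R S).obj P) N i (j + 1) (n + 1) (by omega)) ?_
    refine (congrArg _ (tComp_tmul (P.X i) (N.X j) p q)).trans ?_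
    exact (tComp_tmul (P.X i) (N.X (j + 1)) p (N.d j (j + 1) q)).symm

/-- The comparison map `P ⊗_R N ⟶ (S ⊗_R P) ⊗_S N`. -/
def baseChangeHom : tensorObj P ((restrC R S).obj N) ⟶
    (restrC R S).obj (tensorObj ((extC R S).obj P) N) where
  f n := baseChangeX P N n
  comm' i j hij := by
    obtain rfl : i + 1 = j := hij
    exact baseChangeX_comm P N i

theorem tπ_baseChangeX (i j n : ℤ) (h : i + j = n) (z : (tensorObj P ((restrC R S).obj N)).X n) :
    tπ ((extC R S).obj P) N i j n h (baseChangeX P N n z) =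
      tCompC P N i j (tπ P ((restrC R S).obj N) i j n h z) := by
  have : baseChangeX P N n ≫ (restr R S).map (tπ ((extC R S).obj P) N i j n h) =
      tπ P ((restrC R S).obj N) i j n h ≫ tCompC P N i j := by
    apply tensor_hom_ext
    intro i' j' h'
    have e : tι P ((restrC R S).obj N) i' j' n h' ≫ baseChangeX P N n = _ := tι_tDesc _ _ _ _
    rw [← Category.assoc, e, Category.assoc, ← Functor.map_comp]
    by_cases hi : i' = i
    · subst hi
      obtain rfl : j' = j := by omega
      rw [tι_tπ, tι_tπ_assoc, CategoryTheory.Functor.map_id, Category.comp_id]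
    · rw [tι_tπ_of_ne _ _ _ _ _ _ _ _ _ hi, tι_tπ_of_ne_assoc _ _ _ _ _ _ _ _ _ hi,
        Functor.map_zero, comp_zero]
  exact congr($this z)

theorem baseChangeX_bijective (n : ℤ) : Function.Bijective (baseChangeX P N n) := by
  refine ⟨fun z z' hz => tensor_elt_ext fun i j h => ?_, fun z => ?_⟩
  · apply (tCompC_bijective P N i j).1
    rw [← tπ_baseChangeX, ← tπ_baseChangeX, hz]
  · choose t ht using fun i => (tCompC_bijective P N i (n - i)).2
      (tπ ((extC R S).obj P) N i (n - i) n (by lia) z)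
    obtain ⟨s, hs⟩ := exists_finset_sum_tπ (K := (extC R S).obj P) (L := N) (n := n) z
    refine ⟨∑ i ∈ s, tι P ((restrC R S).obj N) i (n - i) n (by lia) (t i), ?_⟩
    rw [map_sum]
    refine Eq.trans ?_ (hs s subset_rfl).symm
    exact Finset.sum_congr rfl fun i _ => (baseChangeX_tι P N _ _ _ _ _).trans
      (congrArg (tι ((extC R S).obj P) N i (n - i) n (by lia)) (ht i))

theorem quasiIso_baseChangeHom : QuasiIso (baseChangeHom P N) := by
  have : ∀ n, IsIso ((baseChangeHom P N).f n) := fun n =>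
    (ConcreteCategory.isIso_iff_bijective _).2 (baseChangeX_bijective P N n)
  have : IsIso (baseChangeHom P N) := HomologicalComplex.Hom.isIso_of_components _
  infer_instance

end BaseChange

/-! ### Resolving the second tensor factor -/

section Resolution

variable {R : Type u} [CommRing R]

theorem flat_of_projective (M : ModuleCat.{u} R) (hM : Projective M) : Module.Flat R M := by
  have : Module.Projective R M := (IsProjective.iff_projective M).2 hM
  infer_instance

/-- The second argument of the derived tensor product may be replaced by a resolution, too. -/
theorem exists_projective_tensor (P N : Cplx R) (b c : ℤ) [P.IsStrictlyLE b]
    (hP : ∀ i, Projective (P.X i)) [N.IsLE c] :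
    ∃ (H : Cplx R) (g : H ⟶ N), QuasiIso g ∧ QuasiIso (tensorHom (𝟙 P) g) ∧
      (∀ i, Projective (H.X i)) ∧ H.IsStrictlyLE (c + 1) := by
  obtain ⟨H, π, _, hπ, hH, hH'⟩ := exists_epi_quasiIso_projective (N.truncLE c) c
  have hPf := fun i => flat_of_projective _ (hP i)
  have : Mono (N.ιTruncLE c) :=
    inferInstanceAs (Mono (HomologicalComplex.ιTruncLE N (ComplexShape.embeddingUpIntLE c)))
  have hι : QuasiIso (N.ιTruncLE c) := inferInstance
  -- The resolution factors as an epimorphism onto the truncation followed by a monomorphism; `P ⊗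
  -- -` preserves both quasi-isomorphisms because their kernel, respectively cokernel, is acyclic.
  have h₁ := quasiIso_tensorHom_of_epi b hPf π hπ
  have h₂ := quasiIso_tensorHom_of_mono b hPf (N.ιTruncLE c) hι
  have h : tensorHom (𝟙 P) (π ≫ N.ιTruncLE c) =
      tensorHom (𝟙 P) π ≫ tensorHom (𝟙 P) (N.ιTruncLE c) := by
    ext1 n
    apply tensor_hom_ext
    intro i j hij
    rw [comp_f, ← Category.assoc, tι_tensorHom, tι_tensorHom, Category.assoc, tι_tensorHom,
      ← Category.assoc]
    congr 1
    apply ModuleCat.hom_ext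
    apply TensorProduct.ext'
    intro p q
    rfl
  refine ⟨H, π ≫ N.ιTruncLE c, inferInstance, ?_, hH, hH'⟩
  rw [h]
  infer_instance

theorem tensorHom_smul (P H : Cplx R) (x : R) :
    tensorHom (𝟙 P) (x • 𝟙 H) = x • 𝟙 (tensorObj P H) := by
  ext1 n
  apply tensor_hom_ext
  intro i j hij
  rw [tι_tensorHom]
  apply ModuleCat.hom_ext
  apply TensorProduct.ext'
  intro p q
  change tι P H i j n hij (p ⊗ₜ (x • q)) = x • tι P H i j n hij (p ⊗ₜ q)
  rw [← map_smul, tmul_smul]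

end Resolution

/-! ### The two implications -/

section Main

variable {R S : Type u} [CommRing R] [CommRing S] [Algebra R S]

theorem hasBoundedHomology_tensor_restrC_iff (P : Cplx R) (N : Cplx S) :
    HasBoundedHomology (tensorObj P ((restrC R S).obj N)) ↔
      HasBoundedHomology (tensorObj ((extC R S).obj P) N) := by
  rw [HasBoundedHomology.of_quasiIso _ (quasiIso_baseChangeHom P N), hasBoundedHomology_restrC_iff]

variable [IsLocalRing R] [IsLocalRing S] {x : R} (h : IsQuotientBy R S x)
include h

theorem IsQuotientBy.depth_tensor_restrC (hx : x ∈ nonZeroDivisors R) (P : Cplx R) (N : Cplx S)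
    (hb : HasBoundedHomology (tensorObj ((extC R S).obj P) N)) :
    depth R (tensorObj P ((restrC R S).obj N)) = depth S (tensorObj ((extC R S).obj P) N) := by
  rw [depth_congr _ (quasiIso_baseChangeHom P N), h.depth_restrC hx _ hb]

theorem IsQuotientBy.shortExact_smul_tensor (P H : Cplx R) (hP : ∀ i, Module.Flat R (P.X i))
    (hH : ∀ i, IsSMulRegular (H.X i) x) :
    ∃ w, (ShortComplex.mk (x • 𝟙 (tensorObj P H))
      (tensorHom (𝟙 P) (extCUnit R S H)) w).ShortExact := by
  have hS : (ShortComplex.mk (tensorHom (𝟙 P) (x • 𝟙 H)) (tensorHom (𝟙 P) (extCUnit R S H))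
    (tensorHom_comp_eq_zero (Or.inr (h.smul_comp_extCUnit H)))).ShortExact :=
    shortExact_tensor_left P hP (h.shortExact_smul H hH)
  simp only [tensorHom_smul] at hS
  exact ⟨_, hS⟩

/-- The inequality of derived **(ldep)** passes from `R/xR` to `R`. -/
theorem IsQuotientBy.derivedLdep_of_quotient [IsNoetherianRing R] (hx : x ∈ nonZeroDivisors R)
    (hxm : x ∈ IsLocalRing.maximalIdeal R) (hS : DerivedLdep S) : DerivedLdep R := by
  intro M N hM hM' hN hN' F hF
  obtain ⟨P, π, ⟨b, _⟩, hP, hπ⟩ := F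
  change HasBoundedHomology (tensorObj P N) at hF
  change depth R (tensorObj P N) + _ ≥ _
  obtain ⟨-, c, -, hc⟩ := id hN
  -- Replacing `N` by projectives makes `x` regular on its terms, so that `S ⊗ H` is the cokernel of
  -- `x` on `H`.
  obtain ⟨H, g, hg, hPg, hH, hH'⟩ := exists_projective_tensor P N b c hP
  have hPreg := fun i => isSMulRegular_of_projective hx (P.X i)
  have hHreg := fun i => isSMulRegular_of_projective hx (H.X i)
  have hPf := fun i => flat_of_projective _ (hP i)
  have hPb := (HasBoundedHomology.of_quasiIso π hπ).2 hM
  have hHb := (HasBoundedHomology.of_quasiIso g hg).2 hN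
  have hPH := (HasBoundedHomology.of_quasiIso _ hPg).2 hF
  obtain ⟨w, hE⟩ := h.shortExact_smul_tensor P H hPf hHreg
  have hT : HasBoundedHomology (tensorObj ((extC R S).obj P) ((extC R S).obj H)) :=
    (hasBoundedHomology_tensor_restrC_iff P ((extC R S).obj H)).1 (HasBoundedHomology.X₃ hE hPH hPH)
  let F' : ProjRes ((extC R S).obj P) :=
    ⟨(extC R S).obj P, 𝟙 _, ⟨b, isStrictlyLE_extC P b⟩, fun i =>
      haveI := hP i
      projective_ext (P.X i), inferInstance⟩
  have key : depth S (tensorObj ((extC R S).obj P) ((extC R S).obj H)) + depth S (ofModule S) ≥ _ :=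
    hS ((extC R S).obj P) ((extC R S).obj H)
      (h.hasBoundedHomology_extC P hPreg hPb)
      (h.hasFGHomology_extC P hPreg (HasFGHomology.of_quasiIso' π hπ hM'))
      (h.hasBoundedHomology_extC H hHreg hHb)
      (h.hasFGHomology_extC H hHreg (HasFGHomology.of_quasiIso' g hg hN')) F' hT
  have h₁ := depth_coker_smul hxm w hE
  rw [h.depth_tensor_restrC hx _ _ hT, depth_congr _ hPg] at h₁
  have h₂ := h.depth_extC hx hxm P hPreg hPb
  have h₃ := h.depth_extC hx hxm H hHreg hHb
  rw [depth_congr π hπ] at h₂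
  rw [depth_congr g hg] at h₃
  -- Every depth over `R` is written as a depth over `S` plus one, so `1 + 1` is only added to both
  -- sides of `key`; no cancellation in `EReal` is needed.
  rw [← h₁, ← h₂, ← h₃, ← h.depth_ofModule hx hxm, ge_iff_le, add_add_add_comm,
    add_add_add_comm (depth S (tensorObj _ _))]
  exact add_le_add_left key _

omit h in
/-- Suppose that `Y` embeds into an acyclic complex with cokernel `L` and that `L` embeds into `Q`
with cokernel `Y`.  Then the depth of `Q` is smaller than the depth of `Y`. -/
theorem depth_add_one_le {W E L Q : Cplx S} {a : W ⟶ E} {b : E ⟶ L} {c : L ⟶ Q} {d : Q ⟶ W}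
    {w : a ≫ b = 0} {w' : c ≫ d = 0} (h₁ : (ShortComplex.mk a b w).ShortExact)
    (h₂ : (ShortComplex.mk c d w').ShortExact) (hE : E.Acyclic) (hW : HasBoundedHomology W) :
    depth S Q + 1 ≤ depth S W := by
  rw [depth_eq W]
  rcases Set.eq_empty_or_nonempty {i | ¬ ExtVanishes (residueCplx S) W i} with h | h
  · rw [h, einf_empty]
    exact le_top
  obtain ⟨e, he⟩ := exists_isLeast_of_bddBelow (bddBelow_not_extVanishes W hW) h
  obtain ⟨e, rfl⟩ : ∃ e', e = e' + 1 := ⟨e - 1, by omega⟩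
  rw [einf_eq_coe he, depth_eq]
  -- With `e + 1` the depth of `W`, minimality gives `Ext^(e-1)(k, W) = 0`. If also `Ext^e(k, Q) =
  -- 0`, then `Ext^e(k, L) = 0`, and acyclicity of `E` gives `Ext^(e+1)(k, W) = 0`, a contradiction.
  have hQ : ¬ ExtVanishes (residueCplx S) Q e := fun hQ => by
    refine he.1 (ExtVanishes.X₁ h₁ rfl (ExtVanishes.X₁ h₂ (sub_add_cancel e 1) ?_ hQ)
      (.of_acyclic_right hE))
    by_contra hc
    have := he.2 (show e - 1 ∈ _ from hc)
    omega
  refine (add_le_add_left (einf_le (show e ∈ {i | ¬ ExtVanishes (residueCplx S) Q i} from hQ))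
    _).trans ?_
  push_cast
  exact le_rfl

/-- The inequality of derived **(ldep)** passes from `R` to `R/xR`. -/
theorem IsQuotientBy.derivedLdep_quotient (hx : x ∈ nonZeroDivisors R)
    (hxm : x ∈ IsLocalRing.maximalIdeal R) (hR : DerivedLdep R) : DerivedLdep S := by
  intro M N hM hM' hN hN' G hG
  obtain ⟨Y, ρ, ⟨n, _⟩, hY, hρ⟩ := G
  change HasBoundedHomology (tensorObj Y N) at hG
  change depth S (tensorObj Y N) + _ ≥ _
  have := isStrictlyLE_restrC (R := R) Y n
  obtain ⟨P, π, hπ, hπ', hP, hP'⟩ := exists_epi_quasiIso_projective ((restrC R S).obj Y) n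
  obtain ⟨E, L, a, b, c, d, w, w', h₁, h₂, hE⟩ := exists_fourTerm h π hπ'
    fun i => isSMulRegular_of_projective hx (P.X i)
  have hQ : ∀ i, Projective (((extC R S).obj P).X i) := fun i =>
    haveI := hP i
    projective_ext (P.X i)
  -- Both sequences have projective third terms, hence split in each degree: `L` and then `E` are
  -- complexes of projectives, and exactness survives tensoring with the arbitrary complex `N`.
  have hL := projective_X₁ h₂ hQ hY
  have hE' := projective_X₂ h₁ hY hL
  have hEb : E.IsStrictlyLE (n + 1) := by
    have := isStrictlyLE_extC (S := S) P (n + 1)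
    rw [CochainComplex.isStrictlyLE_iff]
    intro i hi
    have hLi : IsZero (L.X i) := by
      have := ModuleCat.subsingleton_of_isZero
        (((extC R S).obj P).isZero_of_isStrictlyLE (n + 1) i hi)
      have := (injective_f_of_shortExact h₂ i).subsingleton
      exact ModuleCat.isZero_of_subsingleton _
    exact (shortExact_eval h₁ i).exact.isZero_of_both_zeros
      ((Y.isZero_of_isStrictlyLE n i (by omega)).eq_of_src _ _) (hLi.eq_of_tgt _ _)
  have ht₁ := shortExact_tensor_right N h₁ hL
  have ht₂ := shortExact_tensor_right N h₂ hY
  have hEN := acyclic_tensorObj_of_projective E N (n + 1) hE' hE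
  have hEN' : HasBoundedHomology (tensorObj E N) :=
    (hasBoundedHomology_iff _).2 ⟨0, 0, fun i _ => hEN i⟩
  have hQN : HasBoundedHomology (tensorObj ((extC R S).obj P) N) :=
    HasBoundedHomology.X₂ ht₂ (HasBoundedHomology.X₃ ht₁ hG hEN') hG
  have hYb := (HasBoundedHomology.of_quasiIso ρ hρ).2 hM
  let F : ProjRes ((restrC R S).obj Y) := ⟨P, π, ⟨n + 1, hP'⟩, hP, hπ'⟩
  have key : depth R (tensorObj P ((restrC R S).obj N)) + depth R (ofModule R) ≥ _ :=
    hR ((restrC R S).obj Y) ((restrC R S).obj N)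
      ((hasBoundedHomology_restrC_iff Y).2 hYb)
      ((h.hasFGHomology_restrC_iff Y).2 (HasFGHomology.of_quasiIso' ρ hρ hM'))
      ((hasBoundedHomology_restrC_iff N).2 hN) ((h.hasFGHomology_restrC_iff N).2 hN') F
      ((hasBoundedHomology_tensor_restrC_iff P N).2 hQN)
  rw [h.depth_tensor_restrC hx P N hQN, h.depth_restrC hx Y hYb, h.depth_restrC hx N hN,
    depth_congr ρ hρ, ← h.depth_ofModule hx hxm] at key
  refine key.trans ?_
  -- The extra `1` from `depth R = depth S + 1` is moved next to `depth ((S ⊗ P) ⊗ N)`, where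
  -- `depth_add_one_le` absorbs it.
  rw [← add_assoc, add_right_comm]
  exact add_le_add_left (depth_add_one_le ht₁ ht₂ hEN hG) _

end Main

theorem isQuotientBy_span_singleton {R : Type u} [CommRing R] (x : R) :
    IsQuotientBy R (R ⧸ Ideal.span {x}) x where
  surjective := Ideal.Quotient.mk_surjective
  algebraMap_eq_zero_iff _ := Ideal.Quotient.eq_zero_iff_mem.trans Ideal.mem_span_singleton

end DerivedDepth

end

theorem proposition4p1 (R : Type u) [CommRing R] [IsLocalRing R] [IsNoetherianRing R]
    (x : R) (hx : x ∈ IsLocalRing.maximalIdeal R) (hreg : x ∈ nonZeroDivisors R) :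
    DerivedDepth.DerivedLdep R ↔
      haveI : IsLocalRing (R ⧸ Ideal.span {x}) := DerivedDepth.isLocalRing_quotient hx
      DerivedDepth.DerivedLdep (R ⧸ Ideal.span {x}) := by
  have : IsLocalRing (R ⧸ Ideal.span {x}) := DerivedDepth.isLocalRing_quotient hx
  have h := DerivedDepth.isQuotientBy_span_singleton x
  exact ⟨h.derivedLdep_quotient hreg hx, h.derivedLdep_of_quotient hreg hx⟩
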